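/- **Definitions.** All spaces are real, $\mathbb N=\{1,2,\dots\}$, and $s\sqsubseteq t$ means that $s$ is an initial segment of $t$. For a family $\mathcal F$ of finite subsets of $\mathbb N$ put $\widehat{\mathcal F}=\{t:\ t\sqsubseteq s\text{ for some }s\in\mathcal F\}$. The family $\mathcal F$ is *regular thin* if no member is a proper initial segment of another one and $\widehat{\mathcal F}$ is compact (its characteristic functions form a closed subset of $\{0,1\}^{\mathbb N}$), hereditary (closed under subsets) and spreading (if $\{n_1<\dots<n_k\}\in\widehat{\mathcal F}$, $m_1<\dots<m_k$ and $n_i\le m_i$ for all $i$, then $\{m_1,\dots,m_k\}\in\widehat{\mathcal F}$). Its order $o(\mathcal F)$ is the rank of $\emptyset$ in the tree $(\widehat{\mathcal F},\sqsubseteq)$, where the rank of $s$ is $\sup\{\operatorname{rank}(t)+1: t\in\widehat{\mathcal F},\ s\sqsubsetneq t\}$ (with $o(\emptyset)=-1$, and $o(\mathcal F)=\omega_1$ if the tree is ill-founded). For an infinite $M=\{M(1)<M(2)<\cdots\}\subseteq\mathbb N$ let $\mathcal F\upharpoonright M=\{s\in\mathcal F:s\subseteq M\}$. A tuple $(s_1,\dots,s_l)$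 of nonempty finite sets is *plegma* if, $s(p)$ denoting the $p$-th element of $s$, $s_i(p)<s_j(p)$ for $i<j$ and $p\le\min(|s_i|,|s_j|)$, and $s_i(p)<s_j(p+1)$ for all $i,j$ and $p\le\min(|s_i|,|s_j|-1)$. Let $\mathcal F$ be regular thin, $(x_s)_{s\in\mathcal F}$ a family in a Banach space $X$, $M$ as above, and $(e_n)$ a linearly independent sequence in a seminormed space. Then $(x_s)_{s\in\mathcal F\upharpoonright M}$ *generates* $(e_n)$ if there are $\delta_l>0$, $\delta_l\to0$, with $$\Big|\ \big\|\textstyle\sum_{j=1}^k a_jx_{s_j}\big\|-\big\|\sum_{j=1}^k a_je_j\big\|\ \Big|\le\delta_l$$ for all $1\le k\le l$, all plegma $k$-tuples $(s_j)_{j=1}^k$ in $\mathcal F\upharpoonright M$ with $\min s_1\ge M(l)$ and all $a_1,\dots,a_k\in[-1,1]$. For $1\le\xi<\omega_1$, $(e_n)$ is a *$\xi$-order spreading model* of $X$ if it is so generated for some regular thin $\mathcal F$ with $o(\mathcal F)=\xi$, some $(x_s)_{s\in\mathcal F}$ in $X$ and some $M$. If $X$ has a fixed Schauder basis, $(e_n)$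 is *plegma block generated* (of order $\xi$) if this can be done with all $x_s$ finitely supported and with $\operatorname{supp}(x_{s_1})<\operatorname{supp}(x_{s_2})$ for every plegma pair $(s_1,s_2)$ in $\mathcal F\upharpoonright M$ (where $A<B$ means that every element of $A$ is smaller than every element of $B$). A sequence $(e_n)$ is a *classical spreading model* of a sequence $(x_n)$ if there are an infinite $M$ and $\delta_l>0$, $\delta_l\to0$, with $\big|\,\|\sum_{j=1}^k a_jx_{M(n_j)}\|-\|\sum_{j=1}^k a_je_j\|\,\big|\le\delta_l$ for all $1\le k\le l\le n_1<\dots<n_k$ and $a_j\in[-1,1]$. A Banach space $E$ with a Schauder basis is a *block strong $k$-order spreading model* of $X$ ($k\ge1$) if there are Banach spaces $E_1,\dots,E_k=E$ with Schauder bases (the last one being the given basis of $E$) such that the basis of $E_1$ is a classical spreading model of some seminormalized Schauder basic sequence in $X$ and, for $1\le i<k$, the basis of $E_{i+1}$ is a classical spreading model of some seminormalized block subsequence of the basis of $E_i$. Here $(y_n)$ is a block subsequence of $(x_n)$ if $y_n=\sum_{i=p_n}^{p_{n+1}-1}a_ix_i$ for some $p_1<p_2<\cdots$ and real $a_i$.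 **Theorem.** Let $X$ be a Banach space. 1. Let $1\le\xi<\omega_1$, let $(e_n)$ be a Schauder basic sequence in some Banach space that is a $\xi$-order spreading model of $X$, and let $E=\overline{\operatorname{span}}\{e_n:n\in\mathbb N\}$ with the basis $(e_n)$. Let $k\ge1$ and let $(\bar e_n)$ be a plegma block generated $k$-order spreading model of $E$. Then $(\bar e_n)$ is a $(\xi+k)$-order spreading model of $X$. 2. Let $k\ge1$ and let $E$, with Schauder basis $(e_n)$, be a block strong $k$-order spreading model of $X$. Then $(e_n)$ is a $k$-order spreading model of $X$. -/

import Mathlib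

open Filter Topology

universe u v w

namespace HigherSpreading

/-! Finite and infinite subsets of the natural numbers. The natural numbers start at `0` here, and
enumerations are indexed from `0`; an infinite set of natural numbers is given by its strictly
increasing enumeration `M : ℕ → ℕ`. -/

/-- `s` is an initial segment of `t`. -/
def InitSeg (s t : Finset ℕ) : Prop :=
  s ⊆ t ∧ ∀ a ∈ t, ∀ b ∈ s, a < b → a ∈ s

/-- The closure of a family under initial segments. -/
def segClosure (F : Set (Finset ℕ)) : Set (Finset ℕ) :=
  {t | ∃ s ∈ F, InitSeg t s}

/-- Hereditary families. -/
def Hereditary (F : Set (Finset ℕ)) : Prop :=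
  ∀ s ∈ F, ∀ t, t ⊆ s → t ∈ F

/-- Spreading families: if `n₁ < ⋯ < n_k` is in the family, `m₁ < ⋯ < m_k` and `nᵢ ≤ mᵢ` for
all `i`, then `{m₁, …, m_k}` is in the family. -/
def Spreading (F : Set (Finset ℕ)) : Prop :=
  ∀ (k : ℕ) (n m : Fin k → ℕ), StrictMono n → StrictMono m → (∀ i, n i ≤ m i) →
    Finset.univ.image n ∈ F → Finset.univ.image m ∈ F

/-- Compact families: the set of characteristic functions is closed in `{0,1}^ℕ`. -/
def CompactFamily (F : Set (Finset ℕ)) : Prop :=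
  IsClosed ((fun (s : Finset ℕ) (n : ℕ) => decide (n ∈ s)) '' F : Set (ℕ → Bool))

/-- Regular families. -/
def Regular (F : Set (Finset ℕ)) : Prop :=
  CompactFamily F ∧ Hereditary F ∧ Spreading F

/-- Thin families: no member is a proper initial segment of another one. -/
def Thin (F : Set (Finset ℕ)) : Prop :=
  ∀ s ∈ F, ∀ t ∈ F, InitSeg s t → s = t

/-- Regular thin families. -/
def RegularThin (F : Set (Finset ℕ)) : Prop :=
  Thin F ∧ Regular (segClosure F)

/-- `t` properly extends `s` within the tree `segClosure F`. -/
def treeRel (F : Set (Finset ℕ)) (t s : Finset ℕ) : Prop :=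
  t ∈ segClosure F ∧ s ∈ segClosure F ∧ InitSeg s t ∧ s ≠ t

open Classical in
/-- The order of a family of finite sets: `-1` (that is `⊥`) for the empty family; `ω₁` if the
tree of initial segments is ill-founded; otherwise the rank of `∅` in this tree, where the rank of
`s` is the supremum of `rank t + 1` over the proper extensions `t` of `s` in the tree. -/
noncomputable def familyOrder (F : Set (Finset ℕ)) : WithBot Ordinal.{0} :=
  if F = ∅ then ⊥
  else if h : IsWellFounded (Finset ℕ) (treeRel F) then
    ((@IsWellFounded.rank (Finset ℕ) (treeRel F) h ∅ : Ordinal.{0}) : WithBot Ordinal.{0})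
  else ((Ordinal.omega 1 : Ordinal.{0}) : WithBot Ordinal.{0})

/-- The restriction of a family to the subsets of the infinite set enumerated by `M`. -/
def restrict (F : Set (Finset ℕ)) (M : ℕ → ℕ) : Set (Finset ℕ) :=
  {s | s ∈ F ∧ ∀ n ∈ s, n ∈ Set.range M}

/-- Plegma tuples of nonempty finite sets; `(s i).orderEmbOfFin rfl ⟨p, _⟩` is the `p`-th element
of `s i` in increasing order, counting from `0`. -/
def Plegma {l : ℕ} (s : Fin l → Finset ℕ) : Prop :=
  (∀ i, (s i).Nonempty) ∧
  (∀ i j : Fin l, i < j → ∀ (p : ℕ) (hi : p < (s i).card) (hj : p < (s j).card),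
    (s i).orderEmbOfFin rfl ⟨p, hi⟩ < (s j).orderEmbOfFin rfl ⟨p, hj⟩) ∧
  (∀ i j : Fin l, ∀ (p : ℕ) (hi : p < (s i).card) (hj : p + 1 < (s j).card),
    (s i).orderEmbOfFin rfl ⟨p, hi⟩ < (s j).orderEmbOfFin rfl ⟨p + 1, hj⟩)

/-- The subsequence `(x_s)`, `s ∈ F ↾ M`, generates `(e_n)` as an `F`-spreading model. Only the
values of `x` on `F` matter. The space `W` carries a seminorm, and `(e_n)` is a Hamel basis of its
span. Since counting starts at `0`, the tuples have `k + 1 ≤ l + 1` members and `M l` is the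
`(l + 1)`-st element of the infinite set. -/
def Generates {X : Type u} [NormedAddCommGroup X] [NormedSpace ℝ X]
    {W : Type v} [SeminormedAddCommGroup W] [NormedSpace ℝ W]
    (F : Set (Finset ℕ)) (x : Finset ℕ → X) (M : ℕ → ℕ) (e : ℕ → W) : Prop :=
  LinearIndependent ℝ e ∧
  ∃ δ : ℕ → ℝ, (∀ l, 0 < δ l) ∧ Tendsto δ atTop (𝓝 0) ∧
    ∀ l k : ℕ, k ≤ l → ∀ s : Fin (k + 1) → Finset ℕ,
      (∀ j, s j ∈ restrict F M) → Plegma s → (∀ n ∈ s 0, M l ≤ n) →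
      ∀ a : Fin (k + 1) → ℝ, (∀ j, a j ∈ Set.Icc (-1 : ℝ) 1) →
        |‖∑ j, a j • x (s j)‖ - ‖∑ j, a j • e (j : ℕ)‖| ≤ δ l

/-- `(e_n)` is a `ξ`-order spreading model of `X`, where `1 ≤ ξ < ω₁`. -/
def IsSpreadingModel (X : Type u) [NormedAddCommGroup X] [NormedSpace ℝ X]
    {W : Type v} [SeminormedAddCommGroup W] [NormedSpace ℝ W]
    (ξ : Ordinal.{0}) (e : ℕ → W) : Prop :=
  1 ≤ ξ ∧ ξ < Ordinal.omega 1 ∧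
  ∃ F : Set (Finset ℕ), RegularThin F ∧ familyOrder F = (ξ : WithBot Ordinal.{0}) ∧
    ∃ (x : Finset ℕ → X) (M : ℕ → ℕ), StrictMono M ∧ Generates F x M e

/-- The support of a vector with respect to a Schauder basis. -/
def supp {E : Type u} [NormedAddCommGroup E] [NormedSpace ℝ E]
    (b : SchauderBasis ℝ E) (x : E) : Set ℕ :=
  {n | b.coord n x ≠ 0}

/-- The subsequence `(x_s)`, `s ∈ F ↾ M`, is plegma block with respect to the basis `b`. -/
def PlegmaBlock {E : Type u} [NormedAddCommGroup E] [NormedSpace ℝ E]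
    (b : SchauderBasis ℝ E) (F : Set (Finset ℕ)) (x : Finset ℕ → E) (M : ℕ → ℕ) : Prop :=
  ∀ s₁ ∈ restrict F M, ∀ s₂ ∈ restrict F M, Plegma ![s₁, s₂] →
    ∀ i ∈ supp b (x s₁), ∀ j ∈ supp b (x s₂), i < j

/-- `(e_n)` is a plegma block generated `ξ`-order spreading model of the space `E` with Schauder
basis `b`. -/
def IsPlegmaBlockSpreadingModel {E : Type u} [NormedAddCommGroup E] [NormedSpace ℝ E]
    {W : Type v} [SeminormedAddCommGroup W] [NormedSpace ℝ W]
    (b : SchauderBasis ℝ E) (ξ : Ordinal.{0}) (e : ℕ → W) : Prop :=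
  1 ≤ ξ ∧ ξ < Ordinal.omega 1 ∧
  ∃ F : Set (Finset ℕ), RegularThin F ∧ familyOrder F = (ξ : WithBot Ordinal.{0}) ∧
    ∃ (x : Finset ℕ → E) (M : ℕ → ℕ), StrictMono M ∧ (∀ s ∈ F, (supp b (x s)).Finite) ∧
      Generates F x M e ∧ PlegmaBlock b F x M

/-- The closed linear span of a sequence. -/
abbrev closedSpan {Z : Type u} [NormedAddCommGroup Z] [NormedSpace ℝ Z] (e : ℕ → Z) :
    Submodule ℝ Z :=
  (Submodule.span ℝ (Set.range e)).topologicalClosure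

/-- `(e_n)` is Schauder basic: it is a Schauder basis of its closed linear span. -/
def IsSchauderBasic {Z : Type u} [NormedAddCommGroup Z] [NormedSpace ℝ Z] (e : ℕ → Z) : Prop :=
  ∃ b : SchauderBasis ℝ (closedSpan e), ∀ n, (b n : Z) = e n

/-- Seminormalized sequences. -/
def Seminormalized {Z : Type u} [NormedAddCommGroup Z] (x : ℕ → Z) : Prop :=
  ∃ c C : ℝ, 0 < c ∧ ∀ n, c ≤ ‖x n‖ ∧ ‖x n‖ ≤ C

/-- `(y_n)` is a block subsequence of `(x_n)`. -/
def IsBlockSequence {Z : Type u} [NormedAddCommGroup Z] [NormedSpace ℝ Z] (x y : ℕ → Z) : Prop :=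
  ∃ (p : ℕ → ℕ) (a : ℕ → ℝ), StrictMono p ∧
    ∀ n, y n = ∑ i ∈ Finset.Ico (p n) (p (n + 1)), a i • x i

/-- `(e_n)` is a (classical, Brunel–Sucheston) spreading model of the sequence `(x_n)`: it is
generated by some subsequence of `(x_n)`. -/
def IsClassicalSpreadingModel {Z : Type u} [NormedAddCommGroup Z] [NormedSpace ℝ Z]
    {W : Type v} [SeminormedAddCommGroup W] [NormedSpace ℝ W] (x : ℕ → Z) (e : ℕ → W) : Prop :=
  ∃ M : ℕ → ℕ, StrictMono M ∧
  ∃ δ : ℕ → ℝ, (∀ l, 0 < δ l) ∧ Tendsto δ atTop (𝓝 0) ∧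
    ∀ l k : ℕ, k ≤ l → ∀ n : Fin (k + 1) → ℕ, StrictMono n → l ≤ n 0 →
      ∀ a : Fin (k + 1) → ℝ, (∀ j, a j ∈ Set.Icc (-1 : ℝ) 1) →
        |‖∑ j, a j • x (M (n j))‖ - ‖∑ j, a j • e (j : ℕ)‖| ≤ δ l

/-- `E`, with its Schauder basis, is a block strong `k`-order spreading model of `X`: there are
Banach spaces `X → E₁ →_bl E₂ →_bl ⋯ →_bl E_k = E` with Schauder bases, the basis of `E₁` being a
spreading model of a seminormalized basic sequence in `X`, and the basis of each later space being
a spreading model of a seminormalized block subsequence of the basis of the preceding space. -/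
inductive IsBlockStrongSpreadingModel (X : Type u) [NormedAddCommGroup X] [NormedSpace ℝ X] :
    ℕ → ∀ (E : Type v) [NormedAddCommGroup E] [NormedSpace ℝ E], SchauderBasis ℝ E → Prop
  | one {E : Type v} [NormedAddCommGroup E] [NormedSpace ℝ E] [CompleteSpace E]
      (b : SchauderBasis ℝ E) (x : ℕ → X) (hx : Seminormalized x) (hbasic : IsSchauderBasic x)
      (hb : IsClassicalSpreadingModel x b) :
      IsBlockStrongSpreadingModel X 1 E b
  | succ {k : ℕ} {E : Type v} [NormedAddCommGroup E] [NormedSpace ℝ E]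
      {E' : Type v} [NormedAddCommGroup E'] [NormedSpace ℝ E'] [CompleteSpace E']
      (b : SchauderBasis ℝ E) (b' : SchauderBasis ℝ E')
      (h : IsBlockStrongSpreadingModel X k E b)
      (y : ℕ → E) (hy : Seminormalized y) (hblock : IsBlockSequence b y)
      (hb : IsClassicalSpreadingModel y b') :
      IsBlockStrongSpreadingModel X (k + 1) E' b'

end HigherSpreading

namespace HigherSpreading

/-! ### Initial segments and positions -/

/-! Let `x_s`, `s ∈ F ↾ M`, generate `(e_n)` with `o(F) = ξ`. A regular thin family of finite order
`k` contains all `k`-element sets far enough out (`exists_forall_card_eq_mem`), so a plegma block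
generated `k`-order model of `E` comes from vectors `y_t = ∑ α_t(j) e_j` indexed by `k`-element sets
`t`, with successive supports along plegma pairs.

To move these vectors into `X`, index them by sets `s = t ∪ u`, where `t` consists of the first `k`
elements, and replace each `e_j` by `x` at a member `v_j(u)` of `F` that is an initial segment of
`θ_j(u)`. The maps `θ_j` are sparse and interlaced: `θ_j(n)` increases with `j`, and the values at
`n` for the relevant `j` lie below all values at larger points. If `(s_i)` is plegma, the supports
of the `α_{t_i}` are successive, so every `j` is used by at most one `i`, and the sets `v_j(u_i)`
that occur form a single plegma tuple in `F`. The norm in `X` is therefore close to the norm of the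
corresponding combination of `(e_n)`. The number of terms and the size of their coefficients depend
only on the `t_i`, whereas the generating error depends on the `u_i`, which start beyond all the
`t_i`; fast growth of `θ_j` makes the total error small (`exists_approximation`).

All `v_j(u)` must exist for the same `u`. This is arranged by taking `u` with `ψ(u) ∈ F` for a
sparse `ψ` dominating the relevant `θ_j`: if a set is moved to the left along sparse points, it
reaches a member of `F` no later than before (`Extending.exists_initSeg`). Passing to preimages
under `ψ` preserves the order (`regularThin_preFamily`), and adding `k` free elements in front turns
`ξ` into `ξ + k` (`regularThin_prolong`).

For the second assertion, a classical spreading model is one of order `1`, indexed by singletons.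
Each further block step is the case `k = 1` of the same construction, and the orders add up by
induction. -/

theorem InitSeg.refl (s : Finset ℕ) : InitSeg s s := ⟨Finset.Subset.refl s, fun _ ha _ _ _ => ha⟩

theorem InitSeg.trans {s t r : Finset ℕ} (h₁ : InitSeg s t) (h₂ : InitSeg t r) : InitSeg s r :=
  ⟨h₁.1.trans h₂.1, fun a ha b hb hab => h₁.2 a (h₂.2 a ha b (h₁.1 hb) hab) b hb hab⟩

theorem InitSeg.card_lt {s t : Finset ℕ} (h : InitSeg s t) (hne : s ≠ t) : s.card < t.card :=
  Finset.card_lt_card (h.1.ssubset_of_ne hne)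

theorem initSeg_empty (s : Finset ℕ) : InitSeg ∅ s :=
  ⟨Finset.empty_subset s, fun _ _ b hb => absurd hb (Finset.notMem_empty b)⟩

theorem initSeg_union {s t : Finset ℕ} (h : ∀ a ∈ s, ∀ b ∈ t, a < b) : InitSeg s (s ∪ t) := by
  refine ⟨Finset.subset_union_left, fun a ha b hb hab => ?_⟩
  rcases Finset.mem_union.1 ha with ha | ha
  · exact ha
  · exact absurd (h b hb a ha) (by omega)

theorem initSeg_insert {s : Finset ℕ} {m : ℕ} (h : ∀ a ∈ s, a < m) :
    InitSeg s (insert m s) := by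
  rw [Finset.insert_eq, Finset.union_comm]
  exact initSeg_union (by simpa using h)

theorem InitSeg.image {f : ℕ → ℕ} {s t : Finset ℕ} (hf : StrictMonoOn f t) (h : InitSeg s t) :
    InitSeg (s.image f) (t.image f) := by
  refine ⟨Finset.image_subset_image h.1, ?_⟩
  simp only [Finset.mem_image]
  rintro _ ⟨a, ha, rfl⟩ _ ⟨b, hb, rfl⟩ hab
  exact ⟨a, h.2 a ha b hb ((hf.lt_iff_lt ha (h.1 hb)).1 hab), rfl⟩

/-- The number of elements of `s` below `n`. -/
def idx (s : Finset ℕ) (n : ℕ) : ℕ := (s.filter (· < n)).card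

theorem idx_mono (s : Finset ℕ) : Monotone (idx s) := fun _ _ h =>
  Finset.card_le_card (Finset.monotone_filter_right s (fun _ _ hx => lt_of_lt_of_le hx h))

theorem idx_lt_idx {s : Finset ℕ} {a b : ℕ} (ha : a ∈ s) (hab : a < b) : idx s a < idx s b := by
  refine Finset.card_lt_card ((Finset.ssubset_iff_of_subset
    (Finset.monotone_filter_right s (fun _ _ hx => lt_trans hx hab))).2 ⟨a, ?_, ?_⟩) <;>
    simp [ha, hab]

theorem idx_lt_card {s : Finset ℕ} {a : ℕ} (ha : a ∈ s) : idx s a < s.card :=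
  Finset.card_lt_card ((Finset.ssubset_iff_of_subset (Finset.filter_subset _ _)).2
    ⟨a, ha, by simp⟩)

theorem idx_injOn (s : Finset ℕ) : Set.InjOn (idx s) s := by
  intro a ha b hb h
  rcases lt_trichotomy a b with hab | hab | hab
  · exact absurd h (idx_lt_idx ha hab).ne
  · exact hab
  · exact absurd h (idx_lt_idx hb hab).ne'

theorem image_idx (s : Finset ℕ) : s.image (idx s) = Finset.range s.card := by
  refine Finset.eq_of_subset_of_card_le ?_ ?_
  · intro n hn
    obtain ⟨a, ha, rfl⟩ := Finset.mem_image.1 hn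
    exact Finset.mem_range.2 (idx_lt_card ha)
  · rw [Finset.card_image_of_injOn (idx_injOn s), Finset.card_range]

theorem exists_idx_eq {s : Finset ℕ} {p : ℕ} (hp : p < s.card) : ∃ a ∈ s, idx s a = p := by
  have := Finset.mem_range.2 hp
  rw [← image_idx] at this
  simpa using this

theorem idx_le_idx_of_subset {s t : Finset ℕ} (h : s ⊆ t) (n : ℕ) : idx s n ≤ idx t n :=
  Finset.card_le_card (Finset.filter_subset_filter _ h)

theorem idx_eq_of_initSeg {s t : Finset ℕ} (h : InitSeg s t) {n : ℕ} (hn : n ∈ s) :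
    idx s n = idx t n := by
  unfold idx
  congr 1
  ext a
  simp only [Finset.mem_filter]
  exact ⟨fun ha => ⟨h.1 ha.1, ha.2⟩, fun ha => ⟨h.2 a ha.1 n hn ha.2, ha.2⟩⟩

theorem idx_image {f : ℕ → ℕ} {s : Finset ℕ} (hf : StrictMonoOn f s) {n : ℕ} (hn : n ∈ s) :
    idx (s.image f) (f n) = idx s n := by
  unfold idx
  rw [Finset.filter_image, Finset.card_image_of_injOn]
  · congr 1
    ext a
    simp only [Finset.mem_filter]
    exact and_congr_right fun ha => hf.lt_iff_lt ha hn
  · exact hf.injOn.mono (Finset.coe_subset.2 (Finset.filter_subset _ _))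

theorem idx_orderEmbOfFin (s : Finset ℕ) (p : Fin s.card) :
    idx s (s.orderEmbOfFin rfl p) = p := by
  have h : StrictMono fun q : Fin s.card =>
      (⟨idx s (s.orderEmbOfFin rfl q), idx_lt_card (s.orderEmbOfFin_mem rfl q)⟩ : Fin s.card) := by
    intro q r hqr
    exact idx_lt_idx (s.orderEmbOfFin_mem rfl q) ((s.orderEmbOfFin rfl).strictMono hqr)
  have hs := Finite.injective_iff_surjective.1 h.injective
  have := DFunLike.congr_fun
    (Subsingleton.elim (StrictMono.orderIsoOfSurjective _ h hs) (OrderIso.refl _)) p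
  exact congrArg Fin.val this

theorem orderEmbOfFin_idx {s : Finset ℕ} {a : ℕ} (ha : a ∈ s) :
    s.orderEmbOfFin rfl ⟨idx s a, idx_lt_card ha⟩ = a :=
  idx_injOn s (s.orderEmbOfFin_mem rfl _) ha (idx_orderEmbOfFin s _)

/-- Plegma tuples in terms of the positions of the elements. -/
theorem plegma_iff {l : ℕ} (s : Fin l → Finset ℕ) :
    Plegma s ↔ (∀ i, (s i).Nonempty) ∧
      (∀ i j, i < j → ∀ a ∈ s i, ∀ b ∈ s j, idx (s i) a = idx (s j) b → a < b) ∧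
      (∀ i j, ∀ a ∈ s i, ∀ b ∈ s j, idx (s i) a + 1 = idx (s j) b → a < b) := by
  constructor
  · rintro ⟨h₀, h₁, h₂⟩
    refine ⟨h₀, fun i j hij a ha b hb hab => ?_, fun i j a ha b hb hab => ?_⟩
    · have := h₁ i j hij (idx (s i) a) (idx_lt_card ha) (hab ▸ idx_lt_card hb)
      simp only [hab, orderEmbOfFin_idx hb] at this
      simpa only [← hab, orderEmbOfFin_idx ha] using this
    · have := h₂ i j (idx (s i) a) (idx_lt_card ha) (hab ▸ idx_lt_card hb)
      simp only [hab, orderEmbOfFin_idx hb] at this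
      simpa only [orderEmbOfFin_idx ha] using this
  · rintro ⟨h₀, h₁, h₂⟩
    refine ⟨h₀, fun i j hij p hi hj => ?_, fun i j p hi hj => ?_⟩
    · exact h₁ i j hij _ (Finset.orderEmbOfFin_mem _ rfl _) _ (Finset.orderEmbOfFin_mem _ rfl _)
        (by rw [idx_orderEmbOfFin, idx_orderEmbOfFin])
    · exact h₂ i j _ (Finset.orderEmbOfFin_mem _ rfl _) _ (Finset.orderEmbOfFin_mem _ rfl _)
        (by rw [idx_orderEmbOfFin, idx_orderEmbOfFin])

/-- The element of `s j` at the position just after that of `a` already exceeds `a`, and `b` is at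
least that element. -/
theorem Plegma.lt_of_idx_lt {l : ℕ} {s : Fin l → Finset ℕ} (h : Plegma s) {i j : Fin l} {a b : ℕ}
    (ha : a ∈ s i) (hb : b ∈ s j) (hab : idx (s i) a < idx (s j) b) : a < b := by
  obtain ⟨c, hc, hca⟩ := exists_idx_eq (s := s j) (lt_of_le_of_lt hab (idx_lt_card hb))
  have hac := ((plegma_iff s).1 h).2.2 i j a ha c hc hca.symm
  by_contra! hba
  exact absurd (idx_lt_idx hb (lt_of_le_of_lt hba hac)) (by omega)

/-! ### The first elements of a finite set, and the rest -/

/-- The first `k` elements of `s`. -/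
def take (k : ℕ) (s : Finset ℕ) : Finset ℕ := s.filter fun n => idx s n < k

/-- The set `s` without its first `k` elements. -/
def drop (k : ℕ) (s : Finset ℕ) : Finset ℕ := s.filter fun n => k ≤ idx s n

theorem mem_take {k : ℕ} {s : Finset ℕ} {n : ℕ} : n ∈ take k s ↔ n ∈ s ∧ idx s n < k :=
  Finset.mem_filter

theorem mem_drop {k : ℕ} {s : Finset ℕ} {n : ℕ} : n ∈ drop k s ↔ n ∈ s ∧ k ≤ idx s n :=
  Finset.mem_filter

theorem initSeg_take (k : ℕ) (s : Finset ℕ) : InitSeg (take k s) s := by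
  refine ⟨Finset.filter_subset _ _, fun a ha b hb hab => mem_take.2 ⟨ha, ?_⟩⟩
  exact lt_of_le_of_lt (idx_mono s hab.le) (mem_take.1 hb).2

theorem card_take {k : ℕ} {s : Finset ℕ} (h : k ≤ s.card) : (take k s).card = k := by
  rw [← Finset.card_image_of_injOn ((idx_injOn s).mono (initSeg_take k s).1)]
  have : (take k s).image (idx s) = Finset.range k := by
    ext p
    simp only [Finset.mem_image, Finset.mem_range, mem_take]
    constructor
    · rintro ⟨a, ha, rfl⟩
      exact ha.2
    · intro hp
      obtain ⟨a, ha, rfl⟩ := exists_idx_eq (lt_of_lt_of_le hp h)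
      exact ⟨a, ⟨ha, hp⟩, rfl⟩
  rw [this, Finset.card_range]

theorem take_lt_drop {k : ℕ} {s : Finset ℕ} {a b : ℕ} (ha : a ∈ take k s) (hb : b ∈ drop k s) :
    a < b := by
  rw [mem_take] at ha
  rw [mem_drop] at hb
  by_contra! h
  exact absurd (idx_mono s h) (by omega)

theorem take_union_drop (k : ℕ) (s : Finset ℕ) : take k s ∪ drop k s = s := by
  ext a
  rw [Finset.mem_union, mem_take, mem_drop, ← and_or_left]
  exact and_iff_left (lt_or_ge _ _)

theorem drop_eq_empty {k : ℕ} {s : Finset ℕ} (h : s.card ≤ k) : drop k s = ∅ :=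
  Finset.filter_eq_empty_iff.2 fun _ ha => not_le.2 (lt_of_lt_of_le (idx_lt_card ha) h)

theorem disjoint_take_drop (k : ℕ) (s : Finset ℕ) : Disjoint (take k s) (drop k s) :=
  Finset.disjoint_left.2 fun _ ha hb => lt_irrefl _ (take_lt_drop ha hb)

theorem card_drop {k : ℕ} {s : Finset ℕ} (h : k ≤ s.card) : (drop k s).card + k = s.card := by
  conv_rhs => rw [← take_union_drop k s, Finset.card_union_of_disjoint (disjoint_take_drop k s),
    card_take h]
  rw [add_comm]

theorem idx_drop {k : ℕ} {s : Finset ℕ} {n : ℕ} (hn : n ∈ drop k s) :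
    idx (drop k s) n + k = idx s n := by
  have hk : k ≤ s.card := (mem_drop.1 hn).2.trans (idx_lt_card (mem_drop.1 hn).1).le
  have : s.filter (· < n) = (drop k s).filter (· < n) ∪ take k s := by
    ext a
    constructor
    · intro ha
      rw [Finset.mem_filter] at ha
      rw [← take_union_drop k s] at ha
      rcases Finset.mem_union.1 ha.1 with h | h
      · exact Finset.mem_union_right _ h
      · exact Finset.mem_union_left _ (Finset.mem_filter.2 ⟨h, ha.2⟩)
    · intro ha
      rcases Finset.mem_union.1 ha with h | h
      · rw [Finset.mem_filter] at h
        exact Finset.mem_filter.2 ⟨(mem_drop.1 h.1).1, h.2⟩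
      · exact Finset.mem_filter.2 ⟨(mem_take.1 h).1, take_lt_drop h hn⟩
  unfold idx
  rw [this, Finset.card_union_of_disjoint, card_take hk]
  exact ((disjoint_take_drop k s).mono_right (Finset.filter_subset _ _)).symm

theorem idx_take {k : ℕ} {s : Finset ℕ} {n : ℕ} (hn : n ∈ take k s) :
    idx (take k s) n = idx s n :=
  idx_eq_of_initSeg (initSeg_take k s) hn

theorem drop_mono {k : ℕ} {s t : Finset ℕ} (h : s ⊆ t) : drop k s ⊆ drop k t := fun _ ha =>
  mem_drop.2 ⟨h (mem_drop.1 ha).1, (mem_drop.1 ha).2.trans (idx_le_idx_of_subset h _)⟩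

theorem InitSeg.drop {k : ℕ} {s t : Finset ℕ} (h : InitSeg s t) : InitSeg (drop k s) (drop k t) := by
  refine ⟨drop_mono h.1, fun a ha b hb hab => ?_⟩
  have has := h.2 a (mem_drop.1 ha).1 b (mem_drop.1 hb).1 hab
  exact mem_drop.2 ⟨has, idx_eq_of_initSeg h has ▸ (mem_drop.1 ha).2⟩

theorem drop_image {k : ℕ} {f : ℕ → ℕ} {s : Finset ℕ} (hf : StrictMonoOn f s) :
    drop k (s.image f) = (drop k s).image f := by
  ext b
  simp only [mem_drop, Finset.mem_image]
  constructor
  · rintro ⟨⟨a, ha, rfl⟩, h⟩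
    exact ⟨a, ⟨ha, idx_image hf ha ▸ h⟩, rfl⟩
  · rintro ⟨a, ⟨ha, h⟩, rfl⟩
    exact ⟨⟨a, ha, rfl⟩, (idx_image hf ha).symm ▸ h⟩

theorem drop_union {k : ℕ} {s t : Finset ℕ} (h : ∀ a ∈ s, ∀ b ∈ t, a < b) (hs : s.card = k) :
    drop k (s ∪ t) = t := by
  have hseg := initSeg_union h
  ext b
  rw [mem_drop, Finset.mem_union]
  constructor
  · rintro ⟨hb | hb, hk⟩
    · rw [← idx_eq_of_initSeg hseg hb] at hk
      exact absurd (idx_lt_card hb) (by omega)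
    · exact hb
  · intro hb
    refine ⟨Or.inr hb, hs ▸ Finset.card_le_card fun a ha => ?_⟩
    exact Finset.mem_filter.2 ⟨Finset.mem_union_left _ ha, h a ha b hb⟩

/-! ### Ranks of well-founded relations -/

theorem isWellFounded_of_ordinal {α : Type} {r : α → α → Prop} (f : α → Ordinal.{0})
    (hf : ∀ a b, r a b → f a < f b) : IsWellFounded α r :=
  ⟨Subrelation.wf (fun {a b} h => hf a b h) (InvImage.wf f Ordinal.lt_wf)⟩

/-- The rank is the least strictly monotone ordinal-valued function; upper bounds for orders of
families are obtained by exhibiting such functions. -/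
theorem rank_le_of_ordinal {α : Type} {r : α → α → Prop} [h : IsWellFounded α r]
    (f : α → Ordinal.{0}) (hf : ∀ a b, r a b → f a < f b) (a : α) :
    IsWellFounded.rank r a ≤ f a := by
  induction a using h.wf.induction with
  | _ a ih =>
    rw [IsWellFounded.rank_eq]
    refine Ordinal.iSup_le fun b => Order.succ_le_of_lt ?_
    exact lt_of_le_of_lt (ih b.1 b.2) (hf _ _ b.2)

/-! ### Trees of initial segments -/

theorem subset_segClosure (F : Set (Finset ℕ)) : F ⊆ segClosure F :=
  fun s hs => ⟨s, hs, InitSeg.refl s⟩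

theorem segClosure_of_initSeg {F : Set (Finset ℕ)} {s t : Finset ℕ} (h : InitSeg s t)
    (ht : t ∈ segClosure F) : s ∈ segClosure F := by
  obtain ⟨w, hw, htw⟩ := ht
  exact ⟨w, hw, h.trans htw⟩

theorem empty_mem_segClosure {F : Set (Finset ℕ)} (h : F.Nonempty) : ∅ ∈ segClosure F := by
  obtain ⟨s, hs⟩ := h
  exact ⟨s, hs, initSeg_empty s⟩

theorem Thin.eq_of_mem_segClosure {F : Set (Finset ℕ)} (h : Thin F) {s t : Finset ℕ} (hs : s ∈ F)
    (ht : t ∈ segClosure F) (hst : InitSeg s t) : s = t := by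
  obtain ⟨w, hw, htw⟩ := ht
  have := h s hs w hw (hst.trans htw)
  subst this
  exact Finset.Subset.antisymm hst.1 htw.1

theorem familyOrder_eq_rank {F : Set (Finset ℕ)} (hF : F.Nonempty)
    (h : IsWellFounded (Finset ℕ) (treeRel F)) :
    familyOrder F = (IsWellFounded.rank (treeRel F) ∅ : Ordinal.{0}) := by
  rw [familyOrder, if_neg hF.ne_empty, dif_pos h]

theorem exists_isWellFounded_of_familyOrder {F : Set (Finset ℕ)} {ξ : Ordinal.{0}}
    (hξ : ξ < Ordinal.omega 1) (h : familyOrder F = (ξ : WithBot Ordinal.{0})) :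
    F.Nonempty ∧ ∃ _ : IsWellFounded (Finset ℕ) (treeRel F),
      IsWellFounded.rank (treeRel F) ∅ = ξ := by
  have hne : F.Nonempty := by
    rw [Set.nonempty_iff_ne_empty]
    intro h0
    rw [familyOrder, if_pos h0] at h
    exact WithBot.bot_ne_coe h
  refine ⟨hne, ?_⟩
  by_cases hwf : IsWellFounded (Finset ℕ) (treeRel F)
  · rw [familyOrder_eq_rank hne hwf] at h
    exact ⟨hwf, WithBot.coe_injective h⟩
  · rw [familyOrder, if_neg hne.ne_empty, dif_neg hwf] at h
    exact absurd (WithBot.coe_injective h) hξ.ne'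

/-! ### Spreading and compactness of trees -/

theorem spreading_iff (F : Set (Finset ℕ)) :
    Spreading F ↔ ∀ (u : Finset ℕ) (f g : ℕ → ℕ), StrictMonoOn f u → StrictMonoOn g u →
      (∀ i ∈ u, f i ≤ g i) → u.image f ∈ F → u.image g ∈ F := by
  constructor
  · intro h u f g hf hg hfg hu
    have key : ∀ f : ℕ → ℕ,
        Finset.univ.image (fun i => f (u.orderEmbOfFin rfl i)) = u.image f := by
      intro f
      ext a
      simp only [Finset.mem_image, Finset.mem_univ, true_and]
      constructor
      · rintro ⟨i, rfl⟩
        exact ⟨_, u.orderEmbOfFin_mem rfl i, rfl⟩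
      · rintro ⟨i, hi, rfl⟩
        exact ⟨_, congrArg f (orderEmbOfFin_idx hi)⟩
    rw [← key]
    refine h u.card (fun i => f (u.orderEmbOfFin rfl i)) _ ?_ ?_ ?_ ((key f).symm ▸ hu)
    · exact fun i j hij => hf (u.orderEmbOfFin_mem rfl i) (u.orderEmbOfFin_mem rfl j)
        ((u.orderEmbOfFin rfl).strictMono hij)
    · exact fun i j hij => hg (u.orderEmbOfFin_mem rfl i) (u.orderEmbOfFin_mem rfl j)
        ((u.orderEmbOfFin rfl).strictMono hij)
    · exact fun i => hfg _ (u.orderEmbOfFin_mem rfl i)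
  · intro h k n m hn hm hnm hF
    have key : ∀ n : Fin k → ℕ,
        (Finset.range k).image (fun p => if hp : p < k then n ⟨p, hp⟩ else 0) =
          Finset.univ.image n := by
      intro n
      ext a
      simp only [Finset.mem_image, Finset.mem_univ, true_and, Finset.mem_range]
      constructor
      · rintro ⟨p, hp, rfl⟩
        exact ⟨⟨p, hp⟩, by rw [dif_pos hp]⟩
      · rintro ⟨i, rfl⟩
        exact ⟨i, i.2, by rw [dif_pos i.2]⟩
    have mono : ∀ n : Fin k → ℕ, StrictMono n →
        StrictMonoOn (fun p => if hp : p < k then n ⟨p, hp⟩ else 0) (Finset.range k) := by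
      intro n hn p hp q hq hpq
      rw [Finset.mem_coe, Finset.mem_range] at hp hq
      simp only [dif_pos hp, dif_pos hq]
      exact hn hpq
    rw [← key] at hF ⊢
    refine h _ _ _ (mono n hn) (mono m hm) (fun p hp => ?_) hF
    rw [Finset.mem_range] at hp
    simp only [dif_pos hp]
    exact hnm _

/-- By heredity, all finite truncations of a limit point lie in the tree. An infinite limit point
would make them an infinite branch, so it is finite and equals one of its truncations. -/
theorem compactFamily_of_isWellFounded {F : Set (Finset ℕ)} (hF : Hereditary (segClosure F))
    (h : IsWellFounded (Finset ℕ) (treeRel F)) : CompactFamily (segClosure F) := by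
  classical
  refine isClosed_of_closure_subset fun f hf => ?_
  have key : ∀ n : ℕ, (Finset.range n).filter (fun i => f i = true) ∈ segClosure F := by
    intro n
    have hU : {g : ℕ → Bool | ∀ i ∈ Finset.range n, g i = f i} ∈ 𝓝 f := by
      have : {g : ℕ → Bool | ∀ i ∈ Finset.range n, g i = f i} =
          (Finset.range n : Set ℕ).pi fun i => {f i} := by
        ext g
        simp [Set.mem_pi]
      rw [this]
      exact set_pi_mem_nhds (Finset.finite_toSet _) fun i _ => by simp
    obtain ⟨g, hg, s, hs, rfl⟩ := mem_closure_iff_nhds.1 hf _ hU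
    refine hF s hs _ fun i hi => ?_
    rw [Finset.mem_filter] at hi
    have := hg i hi.1
    simpa [hi.2] using this
  have hfin : {i | f i = true}.Finite := by
    by_contra hinf
    rw [← Set.Infinite] at hinf
    let c : ℕ → Finset ℕ := fun p =>
      (Finset.range (Nat.nth (fun i => f i = true) p)).filter (fun i => f i = true)
    refine (wellFounded_iff_isEmpty_descending_chain.1 h.wf).elim ⟨c, fun p => ?_⟩
    have hlt : Nat.nth (fun i => f i = true) p < Nat.nth (fun i => f i = true) (p + 1) :=
      Nat.nth_strictMono hinf (Nat.lt_succ_self p)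
    refine ⟨key _, key _, ⟨?_, ?_⟩, fun hc => ?_⟩
    · intro i hi
      simp only [c, Finset.mem_filter, Finset.mem_range] at hi ⊢
      exact ⟨hi.1.trans hlt, hi.2⟩
    · intro a ha b hb hab
      simp only [c, Finset.mem_filter, Finset.mem_range] at ha hb ⊢
      exact ⟨hab.trans hb.1, ha.2⟩
    · have hm : Nat.nth (fun i => f i = true) p ∈ c (p + 1) := by
        simp only [c, Finset.mem_filter, Finset.mem_range]
        exact ⟨hlt, Nat.nth_mem_of_infinite hinf p⟩
      rw [← hc] at hm
      simp [c] at hm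
  refine ⟨hfin.toFinset, ?_, ?_⟩
  · obtain ⟨n, hn⟩ := hfin.bddAbove
    convert key (n + 1) using 1
    ext i
    simp only [Set.Finite.mem_toFinset, Set.mem_ofPred_eq, Finset.mem_filter, Finset.mem_range]
    exact ⟨fun hi => ⟨Nat.lt_succ_of_le (hn hi), hi⟩, fun hi => hi.2⟩
  · funext i
    cases h : f i <;> simp [h]

theorem regularThin_of_isWellFounded {F : Set (Finset ℕ)} (hthin : Thin F)
    (hher : Hereditary (segClosure F)) (hspr : Spreading (segClosure F))
    (h : IsWellFounded (Finset ℕ) (treeRel F)) : RegularThin F :=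
  ⟨hthin, compactFamily_of_isWellFounded hher h, hher, hspr⟩

/-! ### Extending members of the tree by one element -/

/-- Beyond `g n`, every element extends the non-maximal members of the tree that lie below `n`. -/
def Extending (F : Set (Finset ℕ)) (g : ℕ → ℕ) : Prop :=
  Monotone g ∧ (∀ n, n ≤ g n) ∧ ∀ n, ∀ s ∈ segClosure F, s ∉ F → (∀ i ∈ s, i < n) →
    ∀ m, g n ≤ m → insert m s ∈ segClosure F

theorem Spreading.exists_insert {F : Set (Finset ℕ)} (h : Spreading (segClosure F))
    {s : Finset ℕ} (hs : s ∈ segClosure F) (hsF : s ∉ F) :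
    ∃ n, ∀ m, n ≤ m → insert m s ∈ segClosure F := by
  obtain ⟨w, hw, hsw⟩ := hs
  have hne : (w \ s).Nonempty := by
    rw [Finset.sdiff_nonempty]
    intro hws
    exact hsF (Finset.Subset.antisymm hsw.1 hws ▸ hw)
  -- The element of `w` that follows `s`; spreading then allows it to be moved to any `m ≥ n`.
  set n := (w \ s).min' hne with hn
  have hnw : n ∈ w \ s := Finset.min'_mem _ _
  rw [Finset.mem_sdiff] at hnw
  have hlt : ∀ a ∈ s, a < n := by
    intro a ha
    by_contra! hna
    rcases hna.eq_or_lt with h' | h'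
    · exact hnw.2 (h' ▸ ha)
    · exact hnw.2 (hsw.2 n hnw.1 a ha h')
  have hins : insert n s ∈ segClosure F := by
    refine ⟨w, hw, Finset.insert_subset hnw.1 hsw.1, fun a ha b hb hab => ?_⟩
    by_contra hcon
    rw [Finset.mem_insert, not_or] at hcon
    have : n ≤ a := Finset.min'_le _ _ (Finset.mem_sdiff.2 ⟨ha, hcon.2⟩)
    rcases Finset.mem_insert.1 hb with rfl | hb
    · omega
    · exact absurd (hlt b hb) (by omega)
  refine ⟨n, fun m hm => ?_⟩
  have key : ∀ m, n ≤ m → StrictMonoOn (Function.update id n m) ↑(insert n s) ∧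
      (insert n s).image (Function.update id n m) = insert m s := by
    intro m hm
    constructor
    · intro a ha b hb hab
      rw [Finset.mem_coe, Finset.mem_insert] at ha hb
      have han : a ≠ n := by
        rintro rfl
        rcases hb with rfl | hb
        · omega
        · exact absurd (hlt b hb) (by omega)
      rw [Function.update_of_ne han]
      rcases eq_or_ne b n with rfl | hbn
      · rw [Function.update_self]
        exact lt_of_lt_of_le hab hm
      · rwa [Function.update_of_ne hbn]
    · rw [Finset.image_insert, Function.update_self]
      congr 1
      have : s.image (Function.update id n m) = s.image id := by
        refine Finset.image_congr fun a ha => ?_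
        rw [Function.update_of_ne (hlt a ha).ne]
      rw [this, Finset.image_id]
  rw [← (key m hm).2]
  refine (spreading_iff _).1 h _ _ _ (key n le_rfl).1 (key m hm).1 (fun i _ => ?_)
    ((key n le_rfl).2.symm ▸ hins)
  rcases eq_or_ne i n with rfl | hi
  · rwa [Function.update_self, Function.update_self]
  · rw [Function.update_of_ne hi, Function.update_of_ne hi]

theorem Spreading.exists_extending {F : Set (Finset ℕ)} (h : Spreading (segClosure F)) :
    ∃ g, Extending F g := by
  have key : ∀ s : Finset ℕ, ∃ n, s ∈ segClosure F → s ∉ F →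
      ∀ m, n ≤ m → insert m s ∈ segClosure F := by
    intro s
    by_cases hs : s ∈ segClosure F ∧ s ∉ F
    · obtain ⟨n, hn⟩ := h.exists_insert hs.1 hs.2
      exact ⟨n, fun _ _ => hn⟩
    · exact ⟨0, fun h₁ h₂ => absurd ⟨h₁, h₂⟩ hs⟩
  choose q hq using key
  -- Only finitely many sets lie below `n`, so their thresholds have a common bound; the summand `n`
  -- gives `n ≤ g n`.
  refine ⟨fun n => (Finset.range n).powerset.sup q + n, ?_, fun n => Nat.le_add_left _ _, ?_⟩
  · intro n m hnm
    have : (Finset.range n).powerset ⊆ (Finset.range m).powerset :=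
      Finset.powerset_mono.2 (Finset.range_subset_range.2 hnm)
    exact Nat.add_le_add (Finset.sup_mono this) hnm
  · intro n s hs hsF hsn m hm
    refine hq s hs hsF m (le_trans ?_ ((Nat.le_add_right _ n).trans hm))
    exact Finset.le_sup (f := q)
      (Finset.mem_powerset.2 fun i hi => Finset.mem_range.2 (hsn i hi))

/-- The values of `f` on `u` grow as fast as prescribed by `g`. -/
def SparseOn (g f : ℕ → ℕ) (u : Set ℕ) : Prop :=
  (∀ a ∈ u, g 0 ≤ f a) ∧ ∀ a ∈ u, ∀ b ∈ u, a < b → g (f a + 1) ≤ f b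

theorem SparseOn.mono {g f : ℕ → ℕ} {u u' : Set ℕ} (h : SparseOn g f u) (hu : u' ⊆ u) :
    SparseOn g f u' :=
  ⟨fun a ha => h.1 a (hu ha), fun a ha b hb => h.2 a (hu ha) b (hu hb)⟩

theorem SparseOn.strictMonoOn {F : Set (Finset ℕ)} {g f : ℕ → ℕ} {u : Set ℕ} (hg : Extending F g)
    (h : SparseOn g f u) : StrictMonoOn f u := fun a ha b hb hab =>
  lt_of_lt_of_le (Nat.lt_succ_self _) ((hg.2.1 _).trans (h.2 a ha b hb hab))

theorem Extending.image_insert_mem {F : Set (Finset ℕ)} {g f : ℕ → ℕ} {u : Finset ℕ} {m : ℕ}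
    (hg : Extending F g) (hf : SparseOn g f ↑(insert m u)) (hm : ∀ a ∈ u, a < m)
    (hu : u.image f ∈ segClosure F) (huF : u.image f ∉ F) :
    (insert m u).image f ∈ segClosure F := by
  rw [Finset.image_insert]
  rcases u.eq_empty_or_nonempty with rfl | hne
  · exact hg.2.2 0 _ hu huF (by simp) _ (hf.1 m (by simp))
  · have hmax := u.max'_mem hne
    refine hg.2.2 (f (u.max' hne) + 1) _ hu huF ?_ _
      (hf.2 _ (Finset.mem_insert_of_mem hmax) m (by simp) (hm _ hmax))
    intro i hi
    obtain ⟨a, ha, rfl⟩ := Finset.mem_image.1 hi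
    exact Nat.lt_succ_of_le ((hf.strictMonoOn hg).monotoneOn (Finset.mem_insert_of_mem ha)
      (Finset.mem_insert_of_mem hmax) (u.le_max' a ha))

theorem Extending.initSeg_or_mem {F : Set (Finset ℕ)} {g f : ℕ → ℕ} (hne : F.Nonempty)
    (hg : Extending F g) (u : Finset ℕ) (hf : SparseOn g f u) :
    (∃ w ∈ F, InitSeg w (u.image f)) ∨ u.image f ∈ segClosure F := by
  induction u using Finset.induction_on_max with
  | empty => exact Or.inr (by simpa using empty_mem_segClosure hne)
  | insert m u hm ih =>
    have hseg : InitSeg (u.image f) ((insert m u).image f) :=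
      (initSeg_insert hm).image (hf.strictMonoOn hg)
    by_cases hF : u.image f ∈ F
    · exact Or.inl ⟨_, hF, hseg⟩
    · rcases ih (hf.mono (by simp)) with ⟨w, hw, hwu⟩ | hu
      · exact Or.inl ⟨w, hw, hwu.trans hseg⟩
      · exact Or.inr (hg.image_insert_mem hf hm hu hF)

/-- Otherwise `u.image f` is a non-maximal node of the tree and can be extended by a large `c`.
Spreading carries this extension over to `insert c (u.image f')`, which contradicts the maximality
of `u.image f'`. -/
theorem Extending.exists_initSeg {F : Set (Finset ℕ)} {g f f' : ℕ → ℕ} (hF : RegularThin F)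
    (hg : Extending F g) {u : Finset ℕ} (hf : SparseOn g f u) (hf' : StrictMonoOn f' u)
    (hff' : ∀ a ∈ u, f a ≤ f' a) (hu : u.image f' ∈ F) :
    ∃ w ∈ F, InitSeg w (u.image f) := by
  rcases hg.initSeg_or_mem ⟨_, hu⟩ u hf with h | h
  · exact h
  by_cases huF : u.image f ∈ F
  · exact ⟨_, huF, InitSeg.refl _⟩
  exfalso
  obtain ⟨n, hn⟩ := hF.2.2.2.exists_insert h huF
  obtain ⟨m, hm⟩ : ∃ m, ∀ a ∈ u, a < m := ⟨u.sup id + 1, fun a ha =>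
    Nat.lt_succ_of_le (Finset.le_sup (f := id) ha)⟩
  obtain ⟨c, hc⟩ : ∃ c, n ≤ c ∧ ∀ a ∈ u, f' a < c := ⟨n + u.sup f' + 1, by omega, fun a ha => by
    have := Finset.le_sup (f := f') ha
    omega⟩
  have key : ∀ h : ℕ → ℕ, StrictMonoOn h u → (∀ a ∈ u, h a ≤ f' a) →
      StrictMonoOn (Function.update h m c) ↑(insert m u) ∧
      (insert m u).image (Function.update h m c) = insert c (u.image h) := by
    intro h hh hhf'
    constructor
    · intro a ha b hb hab
      rw [Finset.mem_coe, Finset.mem_insert] at ha hb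
      have ham : a ≠ m := by
        rintro rfl
        rcases hb with rfl | hb
        · omega
        · exact absurd (hm b hb) (by omega)
      have hau := ha.resolve_left ham
      rw [Function.update_of_ne ham]
      rcases eq_or_ne b m with rfl | hbm
      · rw [Function.update_self]
        exact lt_of_le_of_lt (hhf' a hau) (hc.2 a hau)
      · rw [Function.update_of_ne hbm]
        exact hh hau (hb.resolve_left hbm) hab
    · rw [Finset.image_insert, Function.update_self]
      congr 1
      refine Finset.image_congr fun a ha => ?_
      rw [Function.update_of_ne (hm a ha).ne]
  have k₁ := key f (hf.strictMonoOn hg) hff'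
  have k₂ := key f' hf' fun _ _ => le_rfl
  have hmem : insert c (u.image f') ∈ segClosure F := by
    rw [← k₂.2]
    refine (spreading_iff _).1 hF.2.2.2 _ _ _ k₁.1 k₂.1 (fun a ha => ?_)
      (k₁.2.symm ▸ hn c hc.1)
    rcases eq_or_ne a m with rfl | ham
    · rw [Function.update_self, Function.update_self]
    · rw [Function.update_of_ne ham, Function.update_of_ne ham]
      exact hff' a ((Finset.mem_insert.1 ha).resolve_left ham)
  have hlt : ∀ a ∈ u.image f', a < c := by
    intro a ha
    obtain ⟨b, hb, rfl⟩ := Finset.mem_image.1 ha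
    exact hc.2 b hb
  have heq := hF.1.eq_of_mem_segClosure hu hmem (initSeg_insert hlt)
  have hcu : c ∈ u.image f' := by
    rw [heq]
    exact Finset.mem_insert_self _ _
  exact lt_irrefl c (hlt c hcu)

/-! ### Preimages of regular thin families -/

/-- The finite sets which `f` maps to members of `F`. -/
def preFamily (f : ℕ → ℕ) (F : Set (Finset ℕ)) : Set (Finset ℕ) := {u | u.image f ∈ F}

/-- For the nontrivial inclusion, append larger and larger points to `u`. Sparseness keeps the image
in the tree until it reaches `F`, which happens because the tree is well-founded. -/
theorem segClosure_preFamily {F : Set (Finset ℕ)} {g f : ℕ → ℕ} (hg : Extending F g)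
    (hf : SparseOn g f Set.univ) (h : IsWellFounded (Finset ℕ) (treeRel F)) :
    segClosure (preFamily f F) = {u | u.image f ∈ segClosure F} := by
  have hmono : StrictMono f := strictMonoOn_univ.1 (hf.strictMonoOn hg)
  ext u
  constructor
  · rintro ⟨w, hw, huw⟩
    exact ⟨_, hw, huw.image (hmono.strictMonoOn _)⟩
  · suffices ∀ t : Finset ℕ, ∀ u : Finset ℕ, u.image f = t → t ∈ segClosure F →
        u ∈ segClosure (preFamily f F) from fun hu => this _ u rfl hu
    intro t
    induction t using h.wf.induction with
    | _ t ih =>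
      rintro u rfl hu
      by_cases huF : u.image f ∈ F
      · exact subset_segClosure _ huF
      obtain ⟨m, hm⟩ : ∃ m, ∀ a ∈ u, a < m := ⟨u.sup id + 1, fun a ha =>
        Nat.lt_succ_of_le (Finset.le_sup (f := id) ha)⟩
      have hmem := hg.image_insert_mem (hf.mono (Set.subset_univ _)) hm hu huF
      have hseg := initSeg_insert hm
      refine segClosure_of_initSeg hseg (ih _ ⟨hmem, hu, hseg.image (hmono.strictMonoOn _), ?_⟩
        _ rfl hmem)
      intro heq
      have := Finset.image_injective hmono.injective heq
      have hmu : m ∈ u := this ▸ Finset.mem_insert_self m u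
      exact lt_irrefl m (hm m hmu)

/-- The ranks agree because the trees map into each other: `u ↦ u.image f` goes one way, and since
`n ≤ f n`, spreading makes the identity go the other way. -/
theorem regularThin_preFamily {F : Set (Finset ℕ)} {g f : ℕ → ℕ} (hF : RegularThin F)
    (hne : F.Nonempty) (hg : Extending F g) (hf : SparseOn g f Set.univ)
    (h : IsWellFounded (Finset ℕ) (treeRel F)) :
    RegularThin (preFamily f F) ∧ (preFamily f F).Nonempty ∧
      ∃ _ : IsWellFounded (Finset ℕ) (treeRel (preFamily f F)),
        IsWellFounded.rank (treeRel (preFamily f F)) ∅ = IsWellFounded.rank (treeRel F) ∅ := by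
  have hmono : StrictMono f := strictMonoOn_univ.1 (hf.strictMonoOn hg)
  have hcl := segClosure_preFamily hg hf h
  have hrel : ∀ t s, treeRel (preFamily f F) t s → treeRel F (t.image f) (s.image f) := by
    rintro t s ⟨ht, hs, hst, hne⟩
    rw [hcl] at ht hs
    exact ⟨ht, hs, hst.image (hmono.strictMonoOn _), fun heq =>
      hne (Finset.image_injective hmono.injective heq)⟩
  have hwf : IsWellFounded (Finset ℕ) (treeRel (preFamily f F)) :=
    isWellFounded_of_ordinal (fun s => IsWellFounded.rank (treeRel F) (s.image f))
      fun t s hts => IsWellFounded.rank_lt_of_rel (hrel t s hts)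
  have hsub : segClosure F ⊆ segClosure (preFamily f F) := by
    intro s hs
    rw [hcl]
    refine (spreading_iff _).1 hF.2.2.2 s id f strictMonoOn_id (hmono.strictMonoOn _)
      (fun i _ => hmono.le_apply) ?_
    rwa [Finset.image_id]
  refine ⟨regularThin_of_isWellFounded ?_ ?_ ?_ hwf, ?_, hwf, le_antisymm ?_ ?_⟩
  · intro s hs t ht hst
    exact Finset.image_injective hmono.injective
      (hF.1 _ hs _ ht (hst.image (hmono.strictMonoOn _)))
  · rw [hcl]
    exact fun s hs t hts => hF.2.2.1 _ hs _ (Finset.image_subset_image hts)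
  · rw [hcl, spreading_iff]
    intro u p q hp hq hpq hu
    rw [Set.mem_ofPred_eq, Finset.image_image] at hu ⊢
    exact (spreading_iff _).1 hF.2.2.2 u _ _ (fun a ha b hb hab => hmono (hp ha hb hab))
      (fun a ha b hb hab => hmono (hq ha hb hab)) (fun i hi => hmono.monotone (hpq i hi)) hu
  · have : ∅ ∈ segClosure (preFamily f F) := hsub (empty_mem_segClosure hne)
    obtain ⟨w, hw, -⟩ := this
    exact ⟨w, hw⟩
  · have := rank_le_of_ordinal (r := treeRel (preFamily f F))
      (fun s => IsWellFounded.rank (treeRel F) (s.image f))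
      (fun t s hts => IsWellFounded.rank_lt_of_rel (hrel t s hts)) ∅
    rwa [Finset.image_empty] at this
  · exact rank_le_of_ordinal (r := treeRel F)
      (fun s => IsWellFounded.rank (treeRel (preFamily f F)) s)
      (fun t s hts => IsWellFounded.rank_lt_of_rel ⟨hsub hts.1, hsub hts.2.1, hts.2.2⟩) ∅

/-! ### Families prolonged by `k` initial elements -/

/-- The finite sets which become members of `F` after removing the first `k` elements. -/
def prolong (k : ℕ) (F : Set (Finset ℕ)) : Set (Finset ℕ) := {s | k ≤ s.card ∧ drop k s ∈ F}

/-- For nonempty `s` any extension within `F` will do, since its new elements come after those of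
`s`; for `s = ∅` a member of `F` is first shifted beyond `n`. -/
theorem Spreading.exists_initSeg_ge {F : Set (Finset ℕ)} (h : Spreading (segClosure F))
    (hne : F.Nonempty) {s : Finset ℕ} (hs : s ∈ segClosure F) {n : ℕ} (hn : ∀ a ∈ s, n ≤ a) :
    ∃ w ∈ F, InitSeg s w ∧ ∀ a ∈ w, n ≤ a := by
  have key : ∀ s : Finset ℕ, s.Nonempty → s ∈ segClosure F → (∀ a ∈ s, n ≤ a) →
      ∃ w ∈ F, InitSeg s w ∧ ∀ a ∈ w, n ≤ a := by
    rintro s ⟨c, hc⟩ ⟨w, hw, hsw⟩ hn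
    refine ⟨w, hw, hsw, fun a ha => ?_⟩
    by_contra! han
    exact absurd (hn a (hsw.2 a ha c hc (lt_of_lt_of_le han (hn c hc)))) (by omega)
  rcases s.eq_empty_or_nonempty with rfl | hs'
  · obtain ⟨w, hw⟩ := hne
    rcases w.eq_empty_or_nonempty with rfl | hw'
    · exact ⟨∅, hw, InitSeg.refl _, by simp⟩
    · have hmem : w.image (· + n) ∈ segClosure F :=
        (spreading_iff _).1 h w id (· + n) strictMonoOn_id
          (fun a _ b _ hab => Nat.add_lt_add_right hab n) (fun i _ => Nat.le_add_right _ _)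
          (by rw [Finset.image_id]; exact subset_segClosure _ hw)
      obtain ⟨w', hw', -, hge⟩ := key _ (hw'.image _) hmem (by simp)
      exact ⟨w', hw', initSeg_empty _, hge⟩
  · exact key s hs' hs hn

theorem segClosure_prolong {F : Set (Finset ℕ)} (h : Spreading (segClosure F)) (hne : F.Nonempty)
    (k : ℕ) : segClosure (prolong k F) = {s | drop k s ∈ segClosure F} := by
  ext s
  constructor
  · rintro ⟨w, hw, hsw⟩
    exact ⟨_, hw.2, hsw.drop⟩
  · have key : ∀ s : Finset ℕ, k ≤ s.card → drop k s ∈ segClosure F →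
        s ∈ segClosure (prolong k F) := by
      intro s hk hs
      obtain ⟨w, hw, hsw, hlt⟩ := h.exists_initSeg_ge hne hs (n := (take k s).sup Nat.succ)
        (fun a ha => Finset.sup_le fun b hb => take_lt_drop hb ha)
      have hlt' : ∀ a ∈ take k s, ∀ b ∈ w, a < b := fun a ha b hb =>
        (Finset.le_sup (f := Nat.succ) ha).trans (hlt b hb)
      refine ⟨take k s ∪ w, ⟨?_, ?_⟩, ?_⟩
      · exact (card_take hk).symm.le.trans (Finset.card_le_card Finset.subset_union_left)
      · rwa [drop_union hlt' (card_take hk)]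
      · conv_lhs => rw [← take_union_drop k s]
        refine ⟨Finset.union_subset_union_right hsw.1, fun a ha b hb hab => ?_⟩
        rw [Finset.mem_union] at ha hb ⊢
        rcases ha with ha | ha
        · exact Or.inl ha
        · rcases hb with hb | hb
          · exact absurd (hlt' b hb a ha) (by omega)
          · exact Or.inr (hsw.2 a ha b hb hab)
    intro hs
    rcases le_or_gt k s.card with hk | hk
    · exact key s hk hs
    -- A set with fewer than `k` elements is first padded to `k` elements with an interval beyond
    -- it.
    · set N := s.sup Nat.succ
      have hlt : ∀ a ∈ s, ∀ b ∈ Finset.Ico N (N + (k - s.card)), a < b := fun a ha b hb =>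
        (Finset.le_sup (f := Nat.succ) ha).trans (Finset.mem_Ico.1 hb).1
      refine segClosure_of_initSeg (initSeg_union hlt) (key _ ?_ ?_) <;>
      have hcard : (s ∪ Finset.Ico N (N + (k - s.card))).card = k := by
        rw [Finset.card_union_of_disjoint (Finset.disjoint_left.2 fun a ha hb =>
          lt_irrefl _ (hlt a ha a hb)), Nat.card_Ico]
        omega
      · exact hcard.symm.le
      · rw [drop_eq_empty hcard.le]
        exact empty_mem_segClosure hne

/-- The first `k` elements are unrestricted and only then does the tree of `F` begin. It sits at the
top of `k` further levels, so the finite summand stands on the right. -/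
theorem regularThin_prolong {F : Set (Finset ℕ)} (hF : RegularThin F) (hne : F.Nonempty)
    (h : IsWellFounded (Finset ℕ) (treeRel F)) (k : ℕ) :
    RegularThin (prolong k F) ∧ familyOrder (prolong k F) =
      ((IsWellFounded.rank (treeRel F) ∅ + k : Ordinal.{0}) : WithBot Ordinal.{0}) := by
  have hcl := segClosure_prolong hF.2.2.2 hne k
  have hempty := empty_mem_segClosure hne
  let ρ := IsWellFounded.rank (treeRel F)
  have hρ : ∀ s ∈ segClosure F, ρ s ≤ ρ ∅ := by
    intro s hs
    rcases eq_or_ne ∅ s with rfl | hs0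
    · exact le_rfl
    · exact (IsWellFounded.rank_lt_of_rel (r := treeRel F)
        ⟨hs, hempty, initSeg_empty s, hs0⟩).le
  have hrank : ∀ t s, treeRel (prolong k F) t s →
      ρ (drop k t) + (k - t.card : ℕ) < ρ (drop k s) + (k - s.card : ℕ) := by
    rintro t s ⟨ht, hs, hst, hne'⟩
    rw [hcl] at ht hs
    have hcard := hst.card_lt hne'
    rcases le_or_gt k s.card with hk | hk
    · rw [Nat.sub_eq_zero_of_le hk, Nat.sub_eq_zero_of_le (hk.trans hcard.le), Nat.cast_zero,
        add_zero, add_zero]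
      refine IsWellFounded.rank_lt_of_rel (r := treeRel F) ⟨ht, hs, hst.drop, fun heq => ?_⟩
      have h₁ := card_drop hk
      have h₂ := card_drop (hk.trans hcard.le)
      rw [heq] at h₁
      omega
    · rw [drop_eq_empty hk.le]
      calc ρ (drop k t) + (k - t.card : ℕ) ≤ ρ ∅ + (k - t.card : ℕ) := by
            gcongr
            exact hρ _ ht
        _ < ρ ∅ + (k - s.card : ℕ) := by
            rw [add_lt_add_iff_left, Nat.cast_lt]
            omega
  have hwf : IsWellFounded (Finset ℕ) (treeRel (prolong k F)) := isWellFounded_of_ordinal _ hrank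
  have hne' : (prolong k F).Nonempty := by
    have : ∅ ∈ segClosure (prolong k F) := by
      rw [hcl]
      simpa [drop] using hempty
    obtain ⟨w, hw, -⟩ := this
    exact ⟨w, hw⟩
  refine ⟨regularThin_of_isWellFounded ?_ ?_ ?_ hwf, ?_⟩
  · intro s hs t ht hst
    have heq := hF.1 _ hs.2 _ ht.2 hst.drop
    have h₁ := card_drop hs.1
    have h₂ := card_drop ht.1
    rw [heq] at h₁
    exact Finset.eq_of_subset_of_card_le hst.1 (by omega)
  · rw [hcl]
    exact fun s hs t hts => hF.2.2.1 _ hs _ (drop_mono hts)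
  · rw [hcl, spreading_iff]
    intro u p q hp hq hpq hu
    rw [Set.mem_ofPred_eq] at hu ⊢
    rw [drop_image hp] at hu
    rw [drop_image hq]
    have hsub : (↑(drop k u) : Set ℕ) ⊆ ↑u := Finset.coe_subset.2 (Finset.filter_subset _ _)
    exact (spreading_iff _).1 hF.2.2.2 _ p q (hp.mono hsub) (hq.mono hsub)
      (fun i hi => hpq i (hsub hi)) hu
  rw [familyOrder_eq_rank hne' hwf]
  congr 1
  apply le_antisymm
  · have := rank_le_of_ordinal (r := treeRel (prolong k F)) _ hrank ∅
    simpa [drop] using this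
  -- For the lower bound, a copy of the tree of `F` is placed above the node `{0, …, k - 1}`.
  · let τ : Finset ℕ → Finset ℕ := fun s => Finset.range k ∪ s.image (· + k)
    have hmono : StrictMono (· + k : ℕ → ℕ) := fun a b hab => Nat.add_lt_add_right hab k
    have hlt : ∀ s : Finset ℕ, ∀ a ∈ Finset.range k, ∀ b ∈ s.image (· + k), a < b := by
      intro s a ha b hb
      obtain ⟨c, hc, rfl⟩ := Finset.mem_image.1 hb
      rw [Finset.mem_range] at ha
      omega
    have hdrop : ∀ s, drop k (τ s) = s.image (· + k) := fun s =>
      drop_union (hlt s) (Finset.card_range k)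
    have hτ : ∀ s ∈ segClosure F, τ s ∈ segClosure (prolong k F) := by
      intro s hs
      rw [hcl, Set.mem_ofPred_eq, hdrop]
      exact (spreading_iff _).1 hF.2.2.2 s id (· + k) strictMonoOn_id (hmono.strictMonoOn _)
        (fun i _ => Nat.le_add_right _ _) (by rwa [Finset.image_id])
    have hrel : ∀ t s, treeRel F t s → treeRel (prolong k F) (τ t) (τ s) := by
      rintro t s ⟨ht, hs, hst, hne⟩
      refine ⟨hτ t ht, hτ s hs, ⟨Finset.union_subset_union_right
        (Finset.image_subset_image hst.1), fun a ha b hb hab => ?_⟩, fun heq => hne ?_⟩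
      · rw [Finset.mem_union] at ha hb ⊢
        rcases ha with ha | ha
        · exact Or.inl ha
        · rcases hb with hb | hb
          · exact absurd (hlt _ b hb a ha) (by omega)
          · exact Or.inr ((hst.image (hmono.strictMonoOn _)).2 a ha b hb hab)
      · have := congrArg (drop k) heq
        rw [hdrop, hdrop] at this
        exact Finset.image_injective hmono.injective this
    have hbase : ρ ∅ ≤ IsWellFounded.rank (treeRel (prolong k F)) (Finset.range k) := by
      have := rank_le_of_ordinal (r := treeRel F)
        (fun s => IsWellFounded.rank (treeRel (prolong k F)) (τ s))
        (fun t s hts => IsWellFounded.rank_lt_of_rel (hrel t s hts)) ∅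
      simpa [τ] using this
    -- From that node, each of the `k` steps down to `∅` raises the rank by at least one.
    have hstep : ∀ i ≤ k, ρ ∅ + i ≤
        IsWellFounded.rank (treeRel (prolong k F)) (Finset.range (k - i)) := by
      intro i
      induction i with
      | zero => intro _; simpa using hbase
      | succ i ih =>
        intro hi
        have hmem : ∀ j ≤ k, Finset.range j ∈ segClosure (prolong k F) := by
          intro j hj
          rw [hcl, Set.mem_ofPred_eq, drop_eq_empty (by simpa using hj)]
          exact hempty
        have hrel : treeRel (prolong k F) (Finset.range (k - i)) (Finset.range (k - (i + 1))) := by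
          refine ⟨hmem _ (Nat.sub_le _ _), hmem _ (Nat.sub_le _ _), ⟨?_, ?_⟩, fun heq => ?_⟩
          · exact Finset.range_subset_range.2 (by omega)
          · intro a _ b hb hab
            rw [Finset.mem_range] at hb ⊢
            omega
          · have := congrArg Finset.card heq
            rw [Finset.card_range, Finset.card_range] at this
            omega
        rw [Nat.cast_succ, ← add_assoc]
        exact Order.add_one_le_of_lt
          (lt_of_le_of_lt (ih (by omega)) (IsWellFounded.rank_lt_of_rel hrel))
    simpa using hstep k le_rfl

/-! ### Composition of spreading models -/

theorem plegma_take {m k : ℕ} {s : Fin m → Finset ℕ} (h : Plegma s) (hk : 1 ≤ k)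
    (hs : ∀ i, k ≤ (s i).card) : Plegma fun i => take k (s i) := by
  rw [plegma_iff] at h ⊢
  refine ⟨fun i => ?_, fun i j hij a ha b hb hab => ?_, fun i j a ha b hb hab => ?_⟩
  · rw [← Finset.card_pos, card_take (hs i)]
    exact hk
  · rw [idx_take ha, idx_take hb] at hab
    exact h.2.1 i j hij a (mem_take.1 ha).1 b (mem_take.1 hb).1 hab
  · rw [idx_take ha, idx_take hb] at hab
    exact h.2.2 i j a (mem_take.1 ha).1 b (mem_take.1 hb).1 hab

theorem Plegma.pair {m : ℕ} {s : Fin m → Finset ℕ} (h : Plegma s) {i j : Fin m} (hij : i < j) :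
    Plegma ![s i, s j] := by
  have hmono : StrictMono ![i, j] := by
    intro p q hpq
    fin_cases p <;> fin_cases q <;> simp_all
  have hs : ![s i, s j] = fun p => s (![i, j] p) := by
    funext p
    fin_cases p <;> rfl
  rw [hs]
  exact ⟨fun p => h.1 _, fun p q hpq => h.2.1 _ _ (hmono hpq), fun p q => h.2.2 _ _⟩

/-- Strictly monotone images and initial segments preserve positions, and `drop k` shifts all of
them by `k`. The plegma inequalities thus pass to the preimages; `hf₁` also separates the sets that
come from the same `s i`. -/
theorem plegma_of_initSeg_image {m q k : ℕ} {s : Fin m → Finset ℕ} (h : Plegma s)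
    {ι : Fin q → Fin m} (hι : Monotone ι) {f : Fin q → ℕ → ℕ} (hf : ∀ j, StrictMono (f j))
    (hf₁ : ∀ i j, i < j → ∀ a, f i a < f j a)
    (hf₂ : ∀ i j, ∀ a ∈ drop k (s (ι i)), ∀ b, a < b → f i a < f j b)
    {t : Fin q → Finset ℕ} (hne : ∀ j, (t j).Nonempty)
    (ht : ∀ j, InitSeg (t j) ((drop k (s (ι j))).image (f j))) : Plegma t := by
  have key : ∀ j, ∀ b ∈ t j, ∃ a ∈ drop k (s (ι j)), a ∈ s (ι j) ∧ f j a = b ∧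
      idx (t j) b + k = idx (s (ι j)) a := by
    intro j b hb
    obtain ⟨a, ha, rfl⟩ := Finset.mem_image.1 ((ht j).1 hb)
    refine ⟨a, ha, (mem_drop.1 ha).1, rfl, ?_⟩
    rw [idx_eq_of_initSeg (ht j) hb, idx_image ((hf j).strictMonoOn _) ha, idx_drop ha]
  rw [plegma_iff]
  refine ⟨hne, fun i j hij a ha b hb hab => ?_, fun i j a ha b hb hab => ?_⟩
  · obtain ⟨a, -, has, rfl, hai⟩ := key i a ha
    obtain ⟨b, -, hbs, rfl, hbi⟩ := key j b hb
    have hle : a ≤ b := by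
      rcases (hι hij.le).eq_or_lt with heq | hlt
      · rw [← heq] at hbs hbi
        exact (idx_injOn _ has hbs (by omega)).le
      · exact (((plegma_iff s).1 h).2.1 _ _ hlt a has b hbs (by omega)).le
    exact (hf₁ i j hij a).trans_le ((hf j).monotone hle)
  · obtain ⟨a, had, has, rfl, hai⟩ := key i a ha
    obtain ⟨b, -, hbs, rfl, hbi⟩ := key j b hb
    exact hf₂ i j a had b (((plegma_iff s).1 h).2.2 _ _ a has b hbs (by omega))

/-- Each index `j` lies in the support of `α i` for at most `i = ι j`, so after exchanging the sums
every inner sum has one term. -/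
theorem sum_smul_linearCombination {E : Type*} [AddCommGroup E] [Module ℝ E] {m q : ℕ}
    (c : Fin m → ℝ) (α : Fin m → ℕ →₀ ℝ) (y : Fin m → ℕ → E) (ι : Fin q → Fin m)
    (h : ∀ i, ∀ j ∈ (α i).support, ∃ hj : j < q, ι ⟨j, hj⟩ = i) :
    ∑ i, c i • Finsupp.linearCombination ℝ (y i) (α i) =
      ∑ j, (c (ι j) * α (ι j) (j : ℕ)) • y (ι j) (j : ℕ) := by
  have key : ∀ i, c i • Finsupp.linearCombination ℝ (y i) (α i) =
      ∑ j : Fin q, (c i * α i (j : ℕ)) • y i (j : ℕ) := by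
    intro i
    rw [Finsupp.linearCombination_apply, Finsupp.sum_of_support_subset _
      (fun j hj => Finset.mem_range.2 (h i j hj).1) _ (by simp),
      ← Fin.sum_univ_eq_sum_range (fun j => α i j • y i j), Finset.smul_sum]
    simp only [mul_smul]
  simp only [key]
  rw [Finset.sum_comm]
  refine Finset.sum_congr rfl fun j _ => Finset.sum_eq_single _ (fun i _ hi => ?_) (by simp)
  have : α i (j : ℕ) = 0 := by
    by_contra hne
    exact hi (h i j (Finsupp.mem_support_iff.2 hne)).2.symm
  rw [this, mul_zero, zero_smul]

theorem norm_sum_smul_eq_mul {E : Type*} [SeminormedAddCommGroup E] [NormedSpace ℝ E] {m : ℕ}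
    {A : ℝ} (hA : 0 < A) (d : Fin m → ℝ) (y : Fin m → E) :
    ‖∑ j, d j • y j‖ = A * ‖∑ j, (A⁻¹ * d j) • y j‖ := by
  simp only [mul_smul, ← Finset.smul_sum]
  rw [norm_smul, norm_inv, Real.norm_of_nonneg hA.le, mul_inv_cancel_left₀ hA.ne']

theorem abs_norm_sum_sub_le_of_abs_le {E E' : Type*} [SeminormedAddCommGroup E] [NormedSpace ℝ E]
    [SeminormedAddCommGroup E'] [NormedSpace ℝ E'] {m : ℕ} {y : Fin m → E} {y' : Fin m → E'}
    {δ A : ℝ} (hA : 0 < A)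
    (h : ∀ a : Fin m → ℝ, (∀ j, a j ∈ Set.Icc (-1 : ℝ) 1) →
      |‖∑ j, a j • y j‖ - ‖∑ j, a j • y' j‖| ≤ δ)
    (d : Fin m → ℝ) (hd : ∀ j, |d j| ≤ A) :
    |‖∑ j, d j • y j‖ - ‖∑ j, d j • y' j‖| ≤ A * δ := by
  rw [norm_sum_smul_eq_mul hA d y, norm_sum_smul_eq_mul hA d y', ← mul_sub, abs_mul, abs_of_pos hA]
  refine mul_le_mul_of_nonneg_left (h _ fun j => ?_) hA.le
  rw [Set.mem_Icc, ← abs_le, abs_mul, abs_of_pos (inv_pos.2 hA), inv_mul_le_iff₀ hA, mul_one]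
  exact hd j

theorem exists_growth (C : ℕ → ℕ) (P : ℕ → ℕ → ℕ) :
    ∃ f : ℕ → ℕ, ∀ n, C n ≤ f n ∧ P n (f n) ≤ f (n + 1) := by
  refine ⟨fun n => Nat.rec (C 0) (fun n B => C (n + 1) + P n B) n, fun n => ⟨?_, ?_⟩⟩
  · cases n with
    | zero => exact le_rfl
    | succ n => exact Nat.le_add_right _ _
  · exact Nat.le_add_left _ _

theorem empty_notMem_of_rank_pos {F : Set (Finset ℕ)} (hF : Thin F)
    [IsWellFounded (Finset ℕ) (treeRel F)] (h : 1 ≤ IsWellFounded.rank (treeRel F) ∅) :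
    ∅ ∉ F := by
  intro hmem
  have key := rank_le_of_ordinal (r := treeRel F) (fun _ => 0) (fun t s hts => ?_) ∅
  · exact absurd (h.trans key) (by simp)
  · exact absurd ((hF.eq_of_mem_segClosure hmem hts.2.1 (initSeg_empty _)).symm.trans
      (hF.eq_of_mem_segClosure hmem hts.1 (initSeg_empty _))) hts.2.2.2

section Blocks

variable {X : Type u} [NormedAddCommGroup X] [NormedSpace ℝ X]
  {W : Type v} [SeminormedAddCommGroup W] [NormedSpace ℝ W]

/-- Suppose that the coefficients `α t` are attached to the sets `t` with `k` elements, in such a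
way that plegma pairs have successive supports, and that `(e_n)` is a `ξ`-order spreading model of
`X`. Then the combinations of `(e_n)` with these coefficients are approximated by vectors of `X`
which are indexed by a regular thin family of order `ξ + k`. -/
theorem exists_approximation {ξ : Ordinal.{0}} {e : ℕ → W} (he : IsSpreadingModel X ξ e)
    {k : ℕ} (hk : 1 ≤ k) (α : Finset ℕ → ℕ →₀ ℝ)
    (hblock : ∀ s₁ s₂ : Finset ℕ, s₁.card = k → s₂.card = k → Plegma ![s₁, s₂] →
      ∀ i ∈ (α s₁).support, ∀ j ∈ (α s₂).support, i < j) :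
    ∃ F : Set (Finset ℕ), RegularThin (prolong k F) ∧
      familyOrder (prolong k F) = ((ξ + k : Ordinal.{0}) : WithBot Ordinal.{0}) ∧
      ∃ z : Finset ℕ → X, ∀ (m l : ℕ) (s : Fin (m + 1) → Finset ℕ), (∀ i, s i ∈ prolong k F) →
        Plegma s → (∀ n ∈ s 0, l ≤ n) → ∀ c : Fin (m + 1) → ℝ, (∀ i, c i ∈ Set.Icc (-1 : ℝ) 1) →
        |‖∑ i, c i • z (s i)‖ -
          ‖∑ i, c i • Finsupp.linearCombination ℝ e (α (take k (s i)))‖| ≤ 1 / ((l : ℝ) + 1) := by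
  obtain ⟨hξ, hξω, F, hF, hord, x, M, hM, -, δ, hδ, hδ0, hgen⟩ := he
  obtain ⟨hne, hwf, hrank⟩ := exists_isWellFounded_of_familyOrder hξω hord
  have hFempty : ∅ ∉ F := empty_notMem_of_rank_pos hF.1 (hrank ▸ hξ)
  obtain ⟨g, hg⟩ := hF.2.2.2.exists_extending
  -- `Q n` bounds the supports and `A n` the coefficients of all `α t` with `t` below `n`; beyond `R
  -- n` the generating error stays small even after multiplication by `A n`.
  let Q : ℕ → ℕ := fun n => (Finset.range n).powerset.sup fun t => (α t).support.sup Nat.succ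
  have hQ : Monotone Q := fun n m hnm => Finset.sup_mono
    (Finset.powerset_mono.2 (Finset.range_subset_range.2 hnm))
  let A : ℕ → ℝ := fun n => 1 + ∑ t ∈ (Finset.range n).powerset, ∑ j ∈ (α t).support, |α t j|
  have hA : ∀ n, 0 < A n := fun n => add_pos_of_pos_of_nonneg one_pos
    (Finset.sum_nonneg fun t _ => Finset.sum_nonneg fun j _ => abs_nonneg _)
  have hαA : ∀ n t, t ⊆ Finset.range n → ∀ j, |α t j| ≤ A n := by
    intro n t ht j
    by_cases hj : j ∈ (α t).support
    · calc |α t j| ≤ ∑ j ∈ (α t).support, |α t j| :=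
            Finset.single_le_sum (f := fun j => |α t j|) (fun j _ => abs_nonneg _) hj
        _ ≤ ∑ t ∈ (Finset.range n).powerset, ∑ j ∈ (α t).support, |α t j| :=
            Finset.single_le_sum (f := fun t => ∑ j ∈ (α t).support, |α t j|)
              (fun t _ => Finset.sum_nonneg fun j _ => abs_nonneg _) (Finset.mem_powerset.2 ht)
        _ ≤ A n := le_add_of_nonneg_left zero_le_one
    · rw [Finsupp.notMem_support_iff.1 hj, abs_zero]
      exact (hA n).le
  have hR : ∀ n : ℕ, ∃ R, ∀ l, R ≤ l → A n * δ l ≤ 1 / ((n : ℝ) + 1) := by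
    intro n
    have : Tendsto (fun l => A n * δ l) atTop (𝓝 0) := by
      simpa using hδ0.const_mul (A n)
    exact eventually_atTop.1 (this.eventually (ge_mem_nhds (by positivity)))
  choose R hR using hR
  -- `big n` is large enough for the error estimate, and `big (n + 1)` leaves room for the shifts by
  -- at most `Q n` and for the threshold `g` beyond them.
  obtain ⟨big, hbig⟩ := exists_growth (fun n => R n + Q n + g 0)
    (fun n B => B + Q n + 1 + g (M (B + Q n) + 1))
  have hbR : ∀ n, R n ≤ big n := fun n => le_trans (by omega) (hbig n).1
  have hbQ : ∀ n, Q n ≤ big n := fun n => le_trans (by omega) (hbig n).1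
  have hbg : ∀ n, g 0 ≤ big n := fun n => le_trans (by omega) (hbig n).1
  have hbs : ∀ n, big n + Q n < big (n + 1) := fun n => lt_of_lt_of_le (by omega) (hbig n).2
  have hbgs : ∀ n, g (M (big n + Q n) + 1) ≤ big (n + 1) := fun n =>
    le_trans (by omega) (hbig n).2
  have hbmono : StrictMono big := strictMono_nat_of_lt_succ fun n =>
    lt_of_le_of_lt (Nat.le_add_right _ _) (hbs n)
  let θ : ℕ → ℕ → ℕ := fun j n => M (big n + j)
  let ψ : ℕ → ℕ := fun n => M (big (n + 1))
  have hθmono : ∀ j, StrictMono (θ j) := fun j a b hab => hM (Nat.add_lt_add_right (hbmono hab) j)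
  -- The growth of `big` only controls shifts `j ≤ Q a`, hence the restricted domain.
  have hθsparse : ∀ j, SparseOn g (θ j) {n | j ≤ Q n} := by
    refine fun j => ⟨fun a _ => ?_, fun a ha b _ hab => ?_⟩
    · exact (hbg a).trans ((Nat.le_add_right _ _).trans hM.le_apply)
    · calc g (θ j a + 1) ≤ g (M (big a + Q a) + 1) :=
            hg.1 (Nat.succ_le_succ (hM.monotone (Nat.add_le_add_left ha _)))
        _ ≤ big b := (hbgs a).trans (hbmono.monotone hab)
        _ ≤ θ j b := (Nat.le_add_right _ _).trans hM.le_apply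
  have hψsparse : SparseOn g ψ Set.univ := by
    refine ⟨fun a _ => (hbg _).trans hM.le_apply, fun a _ b _ hab => ?_⟩
    calc g (ψ a + 1) ≤ g (M (big (a + 1) + Q (a + 1)) + 1) :=
          hg.1 (Nat.succ_le_succ (hM.monotone (Nat.le_add_right _ _)))
      _ ≤ big (b + 1) := (hbgs (a + 1)).trans (hbmono.monotone (by omega))
      _ ≤ ψ b := hM.le_apply
  have hψmono : StrictMono ψ := strictMonoOn_univ.1 (hψsparse.strictMonoOn hg)
  obtain ⟨hF', hne', hwf', hrank'⟩ := regularThin_preFamily hF hne hg hψsparse hwf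
  obtain ⟨hH, hHord⟩ := regularThin_prolong hF' hne' hwf' k
  rw [hrank', hrank] at hHord
  -- On the points with `j ≤ Q n`, `θ j` is sparse and dominated by `ψ`, so `u.image (θ j)` reaches
  -- `F`.
  have hv : ∀ (j : ℕ) (u : Finset ℕ), ∃ t, u ∈ preFamily ψ F → (∀ n ∈ u, j ≤ Q n) →
      t ∈ F ∧ InitSeg t (u.image (θ j)) := by
    intro j u
    by_cases hu : u ∈ preFamily ψ F ∧ ∀ n ∈ u, j ≤ Q n
    · obtain ⟨t, ht, htu⟩ := hg.exists_initSeg hF ((hθsparse j).mono hu.2)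
        (hψmono.strictMonoOn _) (fun a ha => hM.monotone
          ((Nat.add_le_add_left (hu.2 a ha) _).trans (hbs a).le)) hu.1
      exact ⟨t, fun _ _ => ⟨ht, htu⟩⟩
    · exact ⟨∅, fun h₁ h₂ => absurd ⟨h₁, h₂⟩ hu⟩
  choose v hv using hv
  refine ⟨preFamily ψ F, hH, hHord, fun s => Finsupp.linearCombination ℝ
    (fun j => x (v j (drop k s))) (α (take k s)), ?_⟩
  intro m l s hs hpl hl c hc
  have htpl := plegma_take hpl hk fun i => (hs i).1
  set μ : Fin (m + 1) → ℕ := fun i => (α (take k (s i))).support.sup Nat.succ with hμ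
  -- By the plegma property, `N` separates all initial parts `take k (s i)` from all remainders
  -- `drop k (s i)`.
  set N : ℕ := Finset.univ.sup fun i => (take k (s i)).sup Nat.succ with hN
  have htN : ∀ i, take k (s i) ⊆ Finset.range N := by
    intro i a ha
    exact Finset.mem_range.2 ((Finset.le_sup (f := Nat.succ) ha).trans
      (Finset.le_sup (f := fun i => (take k (s i)).sup Nat.succ) (Finset.mem_univ i)))
  have huN : ∀ i, ∀ b ∈ drop k (s i), N ≤ b := by
    intro i b hb
    refine Finset.sup_le fun i' _ => Finset.sup_le fun a ha => ?_
    rw [mem_take] at ha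
    rw [mem_drop] at hb
    exact hpl.lt_of_idx_lt ha.1 hb.1 (ha.2.trans_le hb.2)
  have hμQ : ∀ i, μ i ≤ Q N := fun i => Finset.le_sup
    (f := fun t => (α t).support.sup Nat.succ) (Finset.mem_powerset.2 (htN i))
  have hlN : l ≤ N := by
    obtain ⟨a, ha⟩ := htpl.1 0
    exact (hl a (mem_take.1 ha).1).trans (Finset.mem_range.1 (htN 0 ha)).le
  obtain ⟨q, hq⟩ : ∃ q, q = Finset.univ.sup μ := ⟨_, rfl⟩
  have hμq : ∀ i, μ i ≤ q := fun i => hq ▸ Finset.le_sup (Finset.mem_univ i)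
  have hqQ : q ≤ Q N := hq ▸ Finset.sup_le fun i _ => hμQ i
  have hμlt : ∀ i, ∀ j ∈ (α (take k (s i))).support, j < μ i := fun i j hj =>
    Finset.le_sup (f := Nat.succ) hj
  -- If all supports are empty, both sums vanish; a nonempty tuple is needed to use `hgen`.
  rcases q with _ | q
  · have hα : ∀ i, α (take k (s i)) = 0 := by
      intro i
      rw [← Finsupp.support_eq_empty, Finset.eq_empty_iff_forall_notMem]
      exact fun j hj => absurd ((hμlt i j hj).trans_le (hμq i)) (by omega)
    simp only [hα, map_zero, smul_zero, Finset.sum_const_zero, norm_zero, sub_zero, abs_zero]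
    positivity
  -- Taking the least `i` with `j < μ i` also assigns an `i` to the indices in gaps between
  -- supports, and keeps the assignment monotone.
  have hι : ∀ j : Fin (q + 1), ∃ i, (j : ℕ) < μ i ∧ ∀ i', (j : ℕ) < μ i' → i ≤ i' := by
    intro j
    have hex : ∃ i, (j : ℕ) < μ i := by
      by_contra! hcon
      have : Finset.univ.sup μ ≤ j := Finset.sup_le fun i _ => hcon i
      have := j.2
      omega
    exact ⟨wellFounded_lt.min {i | (j : ℕ) < μ i} hex,
      wellFounded_lt.min_mem {i | (j : ℕ) < μ i} hex,
      fun i' hi' => wellFounded_lt.min_le (s := {i | (j : ℕ) < μ i}) hi'⟩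
  choose ι hι hιmin using hι
  have hιmono : Monotone ι := fun j j' hjj' => hιmin j _ (lt_of_le_of_lt hjj' (hι j'))
  have hιsupp : ∀ i, ∀ j ∈ (α (take k (s i))).support, ∃ hj : j < q + 1, ι ⟨j, hj⟩ = i := by
    intro i j hj
    refine ⟨(hμlt i j hj).trans_le (hμq i), ?_⟩
    set j' : Fin (q + 1) := ⟨j, (hμlt i j hj).trans_le (hμq i)⟩
    by_contra hne
    have hlt : ι j' < i := lt_of_le_of_ne (hιmin j' i (hμlt i j hj)) hne
    have hle : μ (ι j') ≤ j := Finset.sup_le fun p hp =>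
      hblock _ _ (card_take (hs _).1) (card_take (hs _).1) (htpl.pair hlt) p hp j hj
    exact absurd (hι j') (not_lt.2 hle)
  rw [sum_smul_linearCombination c _ (fun i j => x (v j (drop k (s i)))) ι hιsupp,
    sum_smul_linearCombination c _ (fun _ => e) ι hιsupp]
  have hjQ : ∀ j : Fin (q + 1), ∀ n ∈ drop k (s (ι j)), (j : ℕ) < Q n := fun j n hn =>
    (hι j).trans_le ((hμQ _).trans (hQ (huN _ n hn)))
  have hvF : ∀ j : Fin (q + 1), v j (drop k (s (ι j))) ∈ F ∧
      InitSeg (v j (drop k (s (ι j)))) ((drop k (s (ι j))).image (θ j)) := fun j =>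
    hv j _ (hs (ι j)).2 fun n hn => (hjQ j n hn).le
  have hvpl : Plegma fun j : Fin (q + 1) => v j (drop k (s (ι j))) := by
    refine plegma_of_initSeg_image hpl hιmono (fun j => hθmono j) ?_ ?_ (fun j => ?_)
      fun j => (hvF j).2
    · exact fun i j hij a => hM (Nat.add_lt_add_left hij _)
    · intro i j a ha b hab
      refine hM (lt_of_lt_of_le (Nat.add_lt_add_left (hjQ i a ha) _) ?_)
      exact (hbs a).le.trans ((hbmono.monotone hab).trans (Nat.le_add_right _ _))
    · rw [Finset.nonempty_iff_ne_empty]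
      exact fun h0 => hFempty (h0 ▸ (hvF j).1)
  -- The estimate is used at level `big N`: there are at most `Q N` terms, all coefficients are
  -- bounded by `A N`, and the sets start beyond `M (big N)`.
  refine (abs_norm_sum_sub_le_of_abs_le (hA N) (hgen (big N) q
    ((Nat.le_succ q).trans (hqQ.trans (hbQ N))) _ (fun j => ⟨(hvF j).1, fun n hn => ?_⟩) hvpl
    fun n hn => ?_) _ fun j => ?_).trans ((hR N _ (hbR N)).trans ?_)
  · obtain ⟨a, -, rfl⟩ := Finset.mem_image.1 ((hvF j).2.1 hn)
    exact ⟨_, rfl⟩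
  · obtain ⟨a, ha, rfl⟩ := Finset.mem_image.1 ((hvF 0).2.1 hn)
    exact hM.monotone ((hbmono.monotone (huN _ a ha)).trans (Nat.le_add_right _ _))
  · rw [abs_mul]
    calc |c (ι j)| * |α (take k (s (ι j))) j| ≤ 1 * |α (take k (s (ι j))) j| :=
          mul_le_mul_of_nonneg_right (abs_le.2 (hc _)) (abs_nonneg _)
      _ ≤ A N := by
          rw [one_mul]
          exact hαA N _ (htN _) _
  · exact one_div_le_one_div_of_le (by positivity) (by gcongr)

theorem IsSpreadingModel.of_blocks {W' : Type w} [SeminormedAddCommGroup W'] [NormedSpace ℝ W']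
    {ξ : Ordinal.{0}} {e : ℕ → W} (he : IsSpreadingModel X ξ e) {e' : ℕ → W'}
    (he' : LinearIndependent ℝ e') {k : ℕ} (hk : 1 ≤ k) (α : Finset ℕ → ℕ →₀ ℝ)
    (hblock : ∀ s₁ s₂ : Finset ℕ, s₁.card = k → s₂.card = k → Plegma ![s₁, s₂] →
      ∀ i ∈ (α s₁).support, ∀ j ∈ (α s₂).support, i < j)
    {δ : ℕ → ℝ} (hδ : ∀ l, 0 < δ l) (hδ0 : Tendsto δ atTop (𝓝 0))
    (hgen : ∀ l m : ℕ, m ≤ l → ∀ t : Fin (m + 1) → Finset ℕ, (∀ j, (t j).card = k) → Plegma t →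
      (∀ n ∈ t 0, l ≤ n) → ∀ c : Fin (m + 1) → ℝ, (∀ j, c j ∈ Set.Icc (-1 : ℝ) 1) →
        |‖∑ j, c j • Finsupp.linearCombination ℝ e (α (t j))‖ - ‖∑ j, c j • e' (j : ℕ)‖| ≤ δ l) :
    IsSpreadingModel X (ξ + k) e' := by
  obtain ⟨F, hF, hord, z, hz⟩ := exists_approximation he hk α hblock
  have hkω : (k : Ordinal.{0}) < Ordinal.omega 1 :=
    (Ordinal.natCast_lt_omega0 k).trans_le (Ordinal.omega0_le_omega 1)
  refine ⟨he.1.trans le_self_add, Ordinal.isPrincipal_add_omega 1 he.2.1 hkω, prolong k F, hF,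
    hord, z, id, strictMono_id, he', fun l => 1 / ((l : ℝ) + 1) + δ l,
    fun l => add_pos (by positivity) (hδ l), ?_, ?_⟩
  · simpa using tendsto_one_div_add_atTop_nhds_zero_nat.add hδ0
  · intro l m hml s hs hpl hl c hc
    have h₁ := hz m l s (fun i => (hs i).1) hpl hl c hc
    have h₂ := hgen l m hml (fun i => take k (s i)) (fun i => card_take (hs i).1.1)
      (plegma_take hpl hk fun i => (hs i).1.1) (fun n hn => hl n (mem_take.1 hn).1) c hc
    exact (abs_sub_le _ _ _).trans (add_le_add h₁ h₂)

end Blocks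

/-! ### Regular thin families of finite order -/

/-- Each added element lowers the rank, so nodes have at most `k` elements, and some node has
exactly `k`. Spreading gives all `k`-element sets far out, and these are maximal. -/
theorem exists_forall_card_eq_mem {F : Set (Finset ℕ)} (hF : RegularThin F) (hne : F.Nonempty)
    [h : IsWellFounded (Finset ℕ) (treeRel F)] {k : ℕ}
    (hk : IsWellFounded.rank (treeRel F) ∅ = k) :
    ∃ n, ∀ t : Finset ℕ, t.card = k → (∀ a ∈ t, n ≤ a) → t ∈ F := by
  have hle : ∀ s ∈ segClosure F, s.card ≤ k := by
    have key : ∀ s : Finset ℕ, s ∈ segClosure F →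
        IsWellFounded.rank (treeRel F) s + (s.card : Ordinal.{0}) ≤ k := by
      intro s
      induction s using Finset.induction_on_max with
      | empty => intro _; simp [hk]
      | insert m s hm ih =>
        intro hs
        have hseg := initSeg_insert hm
        have hms : m ∉ s := fun hms => lt_irrefl m (hm m hms)
        have hs' := segClosure_of_initSeg hseg hs
        have hlt : IsWellFounded.rank (treeRel F) (insert m s) <
            IsWellFounded.rank (treeRel F) s :=
          IsWellFounded.rank_lt_of_rel ⟨hs, hs', hseg, fun heq =>
            hms (heq ▸ Finset.mem_insert_self m s)⟩
        refine le_trans ?_ (ih hs')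
        rw [Finset.card_insert_of_notMem hms, add_comm s.card, Nat.cast_add, Nat.cast_one,
          ← add_assoc]
        gcongr
        exact Order.add_one_le_of_lt hlt
    intro s hs
    exact_mod_cast le_add_self.trans (key s hs)
  obtain ⟨s, hs, hsk⟩ : ∃ s ∈ segClosure F, s.card = k := by
    by_contra! hcon
    have hlt : ∀ s ∈ segClosure F, s.card < k := fun s hs => (hle s hs).lt_of_ne (hcon s hs)
    have h0 := hlt ∅ (empty_mem_segClosure hne)
    -- If every node had fewer than `k` elements, this function would bound the rank of `∅` by `k -
    -- 1`.
    have := rank_le_of_ordinal (r := treeRel F) (fun s => ((k - 1 - s.card : ℕ) : Ordinal.{0}))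
      (fun t s hts => by
        have h₁ := hts.2.2.1.card_lt hts.2.2.2
        have h₂ := hlt t hts.1
        rw [Nat.cast_lt]
        omega) ∅
    rw [hk, Nat.cast_le] at this
    simp only [Finset.card_empty] at this h0
    omega
  refine ⟨s.sup id, fun t ht htn => ?_⟩
  have hmem : t ∈ segClosure F := by
    have := hF.2.2.2 k (s.orderEmbOfFin hsk) (t.orderEmbOfFin ht) (s.orderEmbOfFin hsk).strictMono
      (t.orderEmbOfFin ht).strictMono (fun i =>
        (Finset.le_sup (f := id) (s.orderEmbOfFin_mem hsk i)).trans
          (htn _ (t.orderEmbOfFin_mem ht i)))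
    rw [Finset.image_orderEmbOfFin_univ, Finset.image_orderEmbOfFin_univ] at this
    exact this hs
  obtain ⟨w, hw, htw⟩ := hmem
  have := Finset.eq_of_subset_of_card_le htw.1 (ht.symm ▸ hle w (subset_segClosure F hw))
  exact this ▸ hw

theorem Plegma.image {m : ℕ} {s : Fin m → Finset ℕ} (h : Plegma s) {f : ℕ → ℕ}
    (hf : StrictMono f) : Plegma fun i => (s i).image f := by
  rw [plegma_iff] at h ⊢
  refine ⟨fun i => (h.1 i).image f, fun i j hij a ha b hb hab => ?_, fun i j a ha b hb hab => ?_⟩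
  all_goals
    obtain ⟨a, ha', rfl⟩ := Finset.mem_image.1 ha
    obtain ⟨b, hb', rfl⟩ := Finset.mem_image.1 hb
    rw [idx_image (hf.strictMonoOn _) ha', idx_image (hf.strictMonoOn _) hb'] at hab
  · exact hf (h.2.1 i j hij a ha' b hb' hab)
  · exact hf (h.2.2 i j a ha' b hb' hab)

theorem exists_linearCombination_eq {E : Type u} [NormedAddCommGroup E] [NormedSpace ℝ E]
    (b : SchauderBasis ℝ E) {x : E} (hx : (supp b x).Finite) :
    ∃ α : ℕ →₀ ℝ, Finsupp.linearCombination ℝ b α = x ∧ ∀ i ∈ α.support, i ∈ supp b x := by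
  refine ⟨Finsupp.ofSupportFinite (fun n => b.coord n x) hx, ?_, fun i hi => ?_⟩
  · obtain ⟨N, hN⟩ := hx.bddAbove
    refine tendsto_nhds_unique (tendsto_const_nhds.congr' ?_) (SchauderBasis.tendsto_proj b x)
    filter_upwards [eventually_gt_atTop N] with n hn
    rw [SchauderBasis.proj_apply, Finsupp.linearCombination_apply,
      Finsupp.sum_of_support_subset _ (s := Finset.range n) _ _ (by simp)]
    · rfl
    · intro i hi
      exact Finset.mem_range.2 ((hN (Finsupp.mem_support_iff.1 hi)).trans_lt hn)
  · exact Finsupp.mem_support_iff.1 hi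

theorem IsPlegmaBlockSpreadingModel.isSpreadingModel {X : Type u} [NormedAddCommGroup X]
    [NormedSpace ℝ X] {Z : Type v} [NormedAddCommGroup Z] [NormedSpace ℝ Z]
    {W : Type w} [SeminormedAddCommGroup W] [NormedSpace ℝ W] {ξ : Ordinal.{0}} {k : ℕ}
    {e : ℕ → Z} {b : SchauderBasis ℝ (closedSpan e)} {e' : ℕ → W} (hb : ∀ n, (b n : Z) = e n)
    (he : IsSpreadingModel X ξ e) (he' : IsPlegmaBlockSpreadingModel b (k : Ordinal.{0}) e') :
    IsSpreadingModel X (ξ + (k : Ordinal.{0})) e' := by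
  obtain ⟨hk, hkω, F, hF, hord, y, N, hN, hfin, ⟨hlin, δ, hδ, hδ0, hgen⟩, hblock⟩ := he'
  obtain ⟨hne, hwf, hrank⟩ := exists_isWellFounded_of_familyOrder hkω hord
  obtain ⟨n₀, hn₀⟩ := exists_forall_card_eq_mem hF hne hrank
  have hk1 : 1 ≤ k := by exact_mod_cast hk
  -- The shift by `n₀` puts the image of every `k`-element set into `F`, while `N l ≤ f n` still
  -- holds for `l ≤ n`.
  let f : ℕ → ℕ := fun n => N (n + n₀)
  have hf : StrictMono f := fun a b hab => hN (Nat.add_lt_add_right hab n₀)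
  have hmem : ∀ t : Finset ℕ, t.card = k → t.image f ∈ restrict F N := by
    intro t ht
    refine ⟨hn₀ _ (by rw [Finset.card_image_of_injective _ hf.injective, ht]) ?_, ?_⟩ <;>
    intro a ha <;> obtain ⟨c, -, rfl⟩ := Finset.mem_image.1 ha
    · exact (Nat.le_add_left _ _).trans hN.le_apply
    · exact ⟨_, rfl⟩
  have hα : ∀ t : Finset ℕ, ∃ α : ℕ →₀ ℝ, t.card = k →
      Finsupp.linearCombination ℝ b α = y (t.image f) ∧
        ∀ i ∈ α.support, i ∈ supp b (y (t.image f)) := by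
    intro t
    by_cases ht : t.card = k
    · obtain ⟨α, hα⟩ := exists_linearCombination_eq b (hfin _ (hmem t ht).1)
      exact ⟨α, fun _ => hα⟩
    · exact ⟨0, fun h => absurd h ht⟩
  choose α hα using hα
  refine he.of_blocks hlin hk1 α ?_ hδ hδ0 ?_
  · intro s₁ s₂ h₁ h₂ hpl i hi j hj
    refine hblock _ (hmem s₁ h₁) _ (hmem s₂ h₂) ?_ i ((hα s₁ h₁).2 i hi) j ((hα s₂ h₂).2 j hj)
    convert hpl.image hf using 1
    funext p
    fin_cases p <;> rfl
  · intro l m hml t ht hpl hl c hc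
    have key : ∑ j, c j • Finsupp.linearCombination ℝ e (α (t j)) =
        ((∑ j, c j • y ((t j).image f) : closedSpan e) : Z) := by
      rw [Submodule.coe_sum]
      refine Finset.sum_congr rfl fun j _ => ?_
      rw [Submodule.coe_smul, ← (hα _ (ht j)).1, ← Submodule.subtype_apply,
        Finsupp.apply_linearCombination,
        show (closedSpan e).subtype ∘ b.basis = e from funext hb]
    rw [key, Submodule.norm_coe]
    refine hgen l m hml _ (fun j => hmem _ (ht j)) (hpl.image hf) (fun n hn => ?_) c hc
    obtain ⟨a, ha, rfl⟩ := Finset.mem_image.1 hn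
    exact hN.monotone ((hl a ha).trans (Nat.le_add_right _ _))

/-! ### Strong spreading models -/

theorem Plegma.exists_eq_singleton {m : ℕ} {t : Fin m → Finset ℕ} (h : Plegma t)
    (ht : ∀ j, (t j).card = 1) : ∃ n : Fin m → ℕ, StrictMono n ∧ ∀ j, t j = {n j} := by
  choose n hn using fun j => Finset.card_eq_one.1 (ht j)
  refine ⟨n, fun i j hij => ?_, hn⟩
  refine ((plegma_iff t).1 h).2.1 i j hij (n i) (by simp [hn i]) (n j) (by simp [hn j]) ?_
  simp [hn, idx, Finset.filter_singleton]

theorem IsClassicalSpreadingModel.isSpreadingModel {X : Type u} [NormedAddCommGroup X]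
    [NormedSpace ℝ X] {W : Type v} [SeminormedAddCommGroup W] [NormedSpace ℝ W] {x : ℕ → X}
    {e : ℕ → W} (h : IsClassicalSpreadingModel x e) (he : LinearIndependent ℝ e) :
    IsSpreadingModel X 1 e := by
  obtain ⟨M, hM, δ, hδ, hδ0, hgen⟩ := h
  have hcl : segClosure {∅} = {∅} := by
    ext s
    constructor
    · rintro ⟨w, rfl, hsw⟩
      exact Finset.subset_empty.1 hsw.1
    · exact fun hs => subset_segClosure _ hs
  have hrel : ∀ t s, ¬ treeRel {∅} t s := by
    rintro t s ⟨ht, hs, -, hne⟩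
    rw [hcl] at ht hs
    exact hne (hs.trans ht.symm)
  have hwf : IsWellFounded (Finset ℕ) (treeRel {∅}) :=
    isWellFounded_of_ordinal (fun _ => 0) fun t s hts => absurd hts (hrel t s)
  have hrank : IsWellFounded.rank (treeRel {∅}) ∅ = 0 := by
    have := rank_le_of_ordinal (r := treeRel {∅}) (fun _ => 0)
      (fun t s hts => absurd hts (hrel t s)) ∅
    simpa using this
  have hreg : RegularThin {∅} := by
    refine regularThin_of_isWellFounded ?_ ?_ ?_ hwf
    · rintro s rfl t rfl -
      rfl
    · rw [hcl]
      rintro s rfl t hts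
      exact Finset.subset_empty.1 hts
    · rw [hcl, spreading_iff]
      intro u p q _ _ _ hu
      have : u = ∅ := Finset.image_eq_empty.1 hu
      subst this
      exact Finset.image_empty _
  obtain ⟨hF, hord⟩ := regularThin_prolong hreg (Set.singleton_nonempty _) hwf 1
  rw [hrank, Nat.cast_one, zero_add] at hord
  refine ⟨le_rfl, Ordinal.one_lt_omega0.trans_le (Ordinal.omega0_le_omega 1), _, hF, hord,
    -- The members of `prolong 1 {∅}` are the singletons, and `sup id` returns their element.
    fun s => x (s.sup id), M, hM, he, δ, hδ, hδ0, ?_⟩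
  intro l k hkl s hs hpl hl a ha
  have hcard : ∀ j, (s j).card = 1 := by
    intro j
    have := card_drop (hs j).1.1
    rw [show drop 1 (s j) = ∅ from (hs j).1.2, Finset.card_empty, zero_add] at this
    exact this.symm
  obtain ⟨n, hn, hsn⟩ := hpl.exists_eq_singleton hcard
  have hrange : ∀ j, ∃ p, M p = n j := fun j => (hs j).2 (n j) (by simp [hsn j])
  choose p hp using hrange
  have hpmono : StrictMono p := fun i j hij => hM.lt_iff_lt.1 (by
    rw [hp, hp]
    exact hn hij)
  have := hgen l k hkl p hpmono (hM.le_iff_le.1 (by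
    rw [hp]
    exact hl _ (by simp [hsn 0]))) a ha
  simpa only [hsn, Finset.sup_singleton, id, hp] using this

/-- This is `IsSpreadingModel.of_blocks` with `k = 1`: a plegma tuple of singletons is an increasing
tuple of numbers, and blocks with increasing indices have successive supports. -/
theorem IsSpreadingModel.succ_of_isBlockSequence {X : Type u} [NormedAddCommGroup X]
    [NormedSpace ℝ X] {E : Type v} [NormedAddCommGroup E] [NormedSpace ℝ E]
    {W : Type w} [SeminormedAddCommGroup W] [NormedSpace ℝ W] {ξ : Ordinal.{0}} {e y : ℕ → E}
    {e' : ℕ → W} (he : IsSpreadingModel X ξ e) (hblock : IsBlockSequence e y)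
    (h : IsClassicalSpreadingModel y e') (he' : LinearIndependent ℝ e') :
    IsSpreadingModel X (ξ + 1) e' := by
  obtain ⟨p, a, hp, hy⟩ := hblock
  obtain ⟨M, hM, δ, hδ, hδ0, hgen⟩ := h
  let I : Finset ℕ → Finset ℕ := fun t => Finset.Ico (p (M (t.sup id))) (p (M (t.sup id) + 1))
  let α : Finset ℕ → ℕ →₀ ℝ := fun t => ∑ i ∈ I t, Finsupp.single i (a i)
  have hα : ∀ n, Finsupp.linearCombination ℝ e (α {n}) = y (M n) := by
    intro n
    simp [α, I, hy]
  have hsupp : ∀ n, ∀ i ∈ (α {n}).support, i ∈ I {n} := by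
    intro n i hi
    obtain ⟨j, hj, hij⟩ := Finset.mem_biUnion.1 (Finsupp.support_finsetSum hi)
    have := Finsupp.support_single_subset hij
    rw [Finset.mem_singleton] at this
    exact this ▸ hj
  rw [← Nat.cast_one]
  refine he.of_blocks he' le_rfl α ?_ hδ hδ0 ?_
  · intro s₁ s₂ h₁ h₂ hpl i hi j hj
    obtain ⟨n, hn, hsn⟩ := hpl.exists_eq_singleton (by
      intro j
      fin_cases j
      exacts [h₁, h₂])
    have e₁ : s₁ = {n 0} := hsn 0
    have e₂ : s₂ = {n 1} := hsn 1
    subst e₁ e₂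
    have hi' := hsupp _ i hi
    have hj' := hsupp _ j hj
    simp only [I, Finset.sup_singleton, id, Finset.mem_Ico] at hi' hj'
    have : M (n 0) + 1 ≤ M (n 1) := hM (hn Fin.zero_lt_one)
    exact hi'.2.trans_le ((hp.monotone this).trans hj'.1)
  · intro l m hml t ht hpl hl c hc
    obtain ⟨n, hn, htn⟩ := hpl.exists_eq_singleton ht
    have := hgen l m hml n hn (hl _ (by simp [htn 0])) c hc
    simpa only [htn, hα] using this

theorem IsBlockStrongSpreadingModel.isSpreadingModel {X : Type u} [NormedAddCommGroup X]
    [NormedSpace ℝ X] {k : ℕ} {E : Type v} [NormedAddCommGroup E] [NormedSpace ℝ E]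
    {b : SchauderBasis ℝ E} (h : IsBlockStrongSpreadingModel X k E b) :
    IsSpreadingModel X (k : Ordinal.{0}) b := by
  induction h with
  | one b x _ _ hb =>
    rw [Nat.cast_one]
    exact hb.isSpreadingModel b.linearIndependent
  | succ b b' _ y _ hblock hb ih =>
    rw [Nat.cast_succ]
    exact ih.succ_of_isBlockSequence hblock hb b'.linearIndependent

end HigherSpreading

theorem mainTheorem7 (X : Type u) [NormedAddCommGroup X] [NormedSpace ℝ X] [CompleteSpace X] :
    (∀ (Z : Type v) [NormedAddCommGroup Z] [NormedSpace ℝ Z] [CompleteSpace Z]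
        (W : Type w) [SeminormedAddCommGroup W] [NormedSpace ℝ W]
        (ξ : Ordinal.{0}) (k : ℕ) (e : ℕ → Z)
        (b : SchauderBasis ℝ (HigherSpreading.closedSpan e)) (e' : ℕ → W),
        (∀ n, (b n : Z) = e n) →
        HigherSpreading.IsSpreadingModel X ξ e →
        HigherSpreading.IsPlegmaBlockSpreadingModel b (k : Ordinal.{0}) e' →
        HigherSpreading.IsSpreadingModel X (ξ + (k : Ordinal.{0})) e') ∧
    (∀ (k : ℕ) (E : Type v) [NormedAddCommGroup E] [NormedSpace ℝ E] [CompleteSpace E]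
        (b : SchauderBasis ℝ E),
        HigherSpreading.IsBlockStrongSpreadingModel X k E b →
        HigherSpreading.IsSpreadingModel X (k : Ordinal.{0}) b) :=
  ⟨fun _ _ _ _ _ _ _ _ _ _ _ _ hb he he' => he'.isSpreadingModel hb he,
    fun _ _ _ _ _ _ h => h.isSpreadingModel⟩
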